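/- Let $M$ be an oriented smooth $n$-dimensional manifold (Hausdorff, $\sigma$-compact), $G$ a Lie group, $\rho: P \to M$ a smooth principal $G$-bundle and $Q$ a smooth manifold with a smooth left action of $G$. Let $P\times_G Q$ be the associated bundle, $P\times_G G$ the gauge group bundle (the associated bundle for the conjugation action of $G$ on itself), and $CP = JP/G$ the connection bundle, whose sections are the principal connections on $P$. For a bundle $\pi: E\to M$ let $JE$ be its first order jet bundle, whose points over $m\in M$ are the pairs $(e,u)$ with $\pi(e)=m$ and $u: T_mM\to T_eE$ linear with $T_e\pi\circ u=\mathrm{id}$, and let $\Gamma(E)$ be the set of its global smooth sections. The bundle $P\times_G G$ acts fibrewise on $P\times_G Q$ by $[p,g]\cdot[p,q]=[p,g\cdot q]$ and on $P$ by $[p,g]\cdot(p\cdot g_0)=p\cdot(gg_0)$. Taking $1$-jets of local sections, $j_m\gamma\cdot j_m\varphi=j_m(\gamma\cdot\varphi)$, one obtains actions of the derived gauge group bundle $J(P\times_G G)$ on $J(P\times_G Q)$ and on $JP$, and the latter passes to the quotient $CP$. The group $\mathrm{Gau}(P)$ of strict automorphisms $f$ of $P$ (equivariant diffeomorphisms over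 $\mathrm{id}_M$) acts on $\Gamma(P\times_G Q)$ through $[p,q]\mapsto[f(p),q]$ and on $\Gamma(CP)$ through $[j_m\sigma]\mapsto[j_m(f\circ\sigma)]$. Assume that every connected component of every fibre of $P\times_G G$ and of $P\times_G Q$ is met by a global smooth section. Equivalently: for all $p\in P$ and $g\in G$ there are $f\in\mathrm{Gau}(P)$ and $g'$ in the connected component of $g$ in $G$ with $f(p)=p\cdot g'$ (automatic if $G$ is connected), and for all $p\in P$ and $q\in Q$ there are $\varphi\in\Gamma(P\times_G Q)$ and $q'$ in the connected component of $q$ in $Q$ with $\varphi(\rho(p))=[p,q']$ (automatic if $Q$ is connected and $P\times_G Q$ has a global section). Then: (1) Let $\mathcal L: J(P\times_G Q)\to\bigwedge^n T^*M$ be a Lagrangian (a continuous, in particular possibly smooth, map over $M$). The functionals $\mathcal S_K[\varphi]=\int_K\mathcal L(\varphi,\partial\varphi)$ on $\Gamma(P\times_G Q)$ are invariant under $\mathrm{Gau}(P)$ for all compact $K\subset M$ if and only if $\mathcal L$ is invariant under the action of $J(P\times_G G)$ on $J(P\times_G Q)$. (2) Let $\mathcal L: CP\times_M J(P\times_G Q)\to\bigwedge^n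 T^*M$ be a Lagrangian (a continuous, in particular possibly smooth, map over $M$). The functionals $\mathcal S_K[A,\varphi]=\int_K\mathcal L(A,\varphi,\partial\varphi)$ on $\Gamma(CP)\times\Gamma(P\times_G Q)$ are invariant under $\mathrm{Gau}(P)$ for all compact $K\subset M$ if and only if $\mathcal L$ is invariant under the combined action of $J(P\times_G G)$ on $CP\times_M J(P\times_G Q)$. -/

import Mathlib

open scoped Manifold ContDiff Topology
open Set

set_option linter.unusedSectionVars false

namespace GaugeTheory

/-- The model space `ℝⁿ`. -/
abbrev 𝔼 (n : ℕ) : Type := EuclideanSpace ℝ (Fin n)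

/-- A smooth principal `G`-bundle over the `n`-dimensional manifold `M`, where `G` is a Lie group of
dimension `d`: a manifold with a smooth right action of `G` (a left action of `Gᵐᵒᵖ`) along the
fibres of a smooth projection to `M`, with smooth equivariant local trivializations. -/
structure PrincipalBundle (n d : ℕ) (G M : Type*) [TopologicalSpace G] [ChartedSpace (𝔼 d) G]
    [Group G] [TopologicalSpace M] [ChartedSpace (𝔼 n) M] where
  /-- The total space. -/
  Carrier : Type*
  [topology : TopologicalSpace Carrier]
  [charted : ChartedSpace (𝔼 (n + d)) Carrier]
  [isManifold : IsManifold (𝓡 (n + d)) ∞ Carrier]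
  [action : MulAction Gᵐᵒᵖ Carrier]
  /-- The bundle projection. -/
  proj : C^∞⟮𝓡 (n + d), Carrier; 𝓡 n, M⟯
  contMDiff_act : ContMDiff ((𝓡 (n + d)).prod (𝓡 d)) (𝓡 (n + d)) ∞
    (fun x : Carrier × G => MulOpposite.op x.2 • x.1)
  proj_act : ∀ (p : Carrier) (g : G), proj (MulOpposite.op g • p) = proj p
  locally_trivial : ∀ m : M, ∃ U : Set M, IsOpen U ∧ m ∈ U ∧
    ∃ Φ : OpenPartialHomeomorph Carrier (M × G),
      Φ.source = proj ⁻¹' U ∧ Φ.target = U ×ˢ univ ∧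
      ContMDiffOn (𝓡 (n + d)) ((𝓡 n).prod (𝓡 d)) ∞ Φ Φ.source ∧
      ContMDiffOn ((𝓡 n).prod (𝓡 d)) (𝓡 (n + d)) ∞ Φ.symm Φ.target ∧
      (∀ p ∈ Φ.source, (Φ p).1 = proj p) ∧
      ∀ p ∈ Φ.source, ∀ g : G, (Φ (MulOpposite.op g • p)).2 = (Φ p).2 * g

attribute [instance] PrincipalBundle.topology PrincipalBundle.charted PrincipalBundle.isManifold
  PrincipalBundle.action

theorem contDiffOn_of_contMDiffOn_model {E H : Type*} [NormedAddCommGroup E] [NormedSpace ℝ E]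
    [TopologicalSpace H] {I : ModelWithCorners ℝ E H} {f : H → H} {s : Set H}
    (hf : ContMDiffOn I I ∞ f s) : ContDiffOn ℝ ∞ (I ∘ f ∘ I.symm) (I.symm ⁻¹' s ∩ range I) := by
  intro y hy
  have h := (contMDiffOn_iff.1 hf).2 (I.symm y) (f (I.symm y))
  simp only [extChartAt, chartAt_self_eq, mfld_simps] at h
  rw [inter_comm]
  exact h y ⟨hy.2, hy.1⟩

section Bundle

variable {n d k : ℕ} {G M : Type*}
  [TopologicalSpace G] [ChartedSpace (𝔼 d) G] [Group G] [LieGroup (𝓡 d) ∞ G]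
  [TopologicalSpace M] [ChartedSpace (𝔼 n) M] [IsManifold (𝓡 n) ∞ M]

namespace PrincipalBundle

/-- The right action of the structure group on the total space, `p ↦ p · g`. -/
def act (B : PrincipalBundle n d G M) (p : B.Carrier) (g : G) : B.Carrier := MulOpposite.op g • p

variable (B : PrincipalBundle n d G M)

theorem act_one (p : B.Carrier) : B.act p 1 = p := by simp [act]

theorem act_mul (p : B.Carrier) (g h : G) : B.act p (g * h) = B.act (B.act p g) h := by
  simp [act, mul_smul]

theorem proj_act' (p : B.Carrier) (g : G) : B.proj (B.act p g) = B.proj p := B.proj_act p g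

theorem contMDiff_act' : ContMDiff ((𝓡 (n + d)).prod (𝓡 d)) (𝓡 (n + d)) ∞
    (fun x : B.Carrier × G => B.act x.1 x.2) := B.contMDiff_act

/-- An equivariant smooth local trivialization of a principal bundle. -/
structure LocalTriv where
  /-- The domain in the base manifold. -/
  base : Set M
  isOpen_base : IsOpen base
  /-- The trivialization as a partial homeomorphism. -/
  hom : OpenPartialHomeomorph B.Carrier (M × G)
  source_eq : hom.source = B.proj ⁻¹' base
  target_eq : hom.target = base ×ˢ univ
  contMDiffOn_hom : ContMDiffOn (𝓡 (n + d)) ((𝓡 n).prod (𝓡 d)) ∞ hom hom.source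
  contMDiffOn_symm : ContMDiffOn ((𝓡 n).prod (𝓡 d)) (𝓡 (n + d)) ∞ hom.symm hom.target
  fst_hom : ∀ p ∈ hom.source, (hom p).1 = B.proj p
  snd_hom : ∀ p ∈ hom.source, ∀ g : G, (hom (B.act p g)).2 = (hom p).2 * g

theorem exists_localTriv (m : M) : ∃ T : B.LocalTriv, m ∈ T.base := by
  obtain ⟨U, hU, hm, Φ, h1, h2, h3, h4, h5, h6⟩ := B.locally_trivial m
  exact ⟨⟨U, hU, Φ, h1, h2, h3, h4, h5, h6⟩, hm⟩

/-- A chosen local trivialization around a point. -/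
noncomputable def localTriv (m : M) : B.LocalTriv := (B.exists_localTriv m).choose

theorem mem_localTriv (m : M) : m ∈ (B.localTriv m).base := (B.exists_localTriv m).choose_spec

namespace LocalTriv

variable {B} (T : B.LocalTriv)

theorem mem_source {p : B.Carrier} : p ∈ T.hom.source ↔ B.proj p ∈ T.base := by
  rw [T.source_eq]; rfl

theorem mem_target {x : M × G} : x ∈ T.hom.target ↔ x.1 ∈ T.base := by
  rw [T.target_eq]; simp

/-- The local section of the principal bundle defined by a local trivialization. -/
def sec (x : M) : B.Carrier := T.hom.symm (x, 1)

theorem sec_mem {x : M} (hx : x ∈ T.base) : T.sec x ∈ T.hom.source :=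
  T.hom.map_target (T.mem_target.2 hx)

theorem hom_sec {x : M} (hx : x ∈ T.base) : T.hom (T.sec x) = (x, 1) :=
  T.hom.right_inv (T.mem_target.2 hx)

theorem proj_sec {x : M} (hx : x ∈ T.base) : B.proj (T.sec x) = x := by
  rw [← T.fst_hom _ (T.sec_mem hx), T.hom_sec hx]

theorem act_sec {p : B.Carrier} (hp : p ∈ T.hom.source) :
    B.act (T.sec (B.proj p)) (T.hom p).2 = p := by
  have hb := T.mem_source.1 hp
  have hs := T.sec_mem hb
  have hs' : B.act (T.sec (B.proj p)) (T.hom p).2 ∈ T.hom.source := by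
    rw [T.mem_source, B.proj_act', T.proj_sec hb]; exact hb
  apply T.hom.injOn hs' hp
  apply Prod.ext
  · rw [T.fst_hom _ hs', T.fst_hom _ hp, B.proj_act', T.proj_sec hb]
  · rw [T.snd_hom _ hs, T.hom_sec hb, one_mul]

theorem contMDiffOn_sec : ContMDiffOn (𝓡 n) (𝓡 (n + d)) ∞ T.sec T.base := by
  have : ContMDiffOn (𝓡 n) ((𝓡 n).prod (𝓡 d)) ∞ (fun x : M => (x, (1 : G))) T.base :=
    contMDiffOn_id.prodMk contMDiffOn_const
  exact T.contMDiffOn_symm.comp this fun x hx => T.mem_target.2 hx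

end LocalTriv

/-- Two points in the same fibre differ by a unique element of the structure group. -/
theorem exists_act_eq {p p' : B.Carrier} (h : B.proj p = B.proj p') : ∃ g, B.act p g = p' := by
  set T := B.localTriv (B.proj p)
  have hp : p ∈ T.hom.source := T.mem_source.2 (B.mem_localTriv _)
  have hp' : p' ∈ T.hom.source := T.mem_source.2 (h ▸ B.mem_localTriv _)
  refine ⟨(T.hom p).2⁻¹ * (T.hom p').2, ?_⟩
  calc B.act p ((T.hom p).2⁻¹ * (T.hom p').2)
      = B.act (B.act (T.sec (B.proj p)) (T.hom p).2) ((T.hom p).2⁻¹ * (T.hom p').2) := by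
        rw [T.act_sec hp]
    _ = p' := by rw [← B.act_mul, mul_inv_cancel_left, h, T.act_sec hp']

theorem act_injective (p : B.Carrier) {g h : G} (e : B.act p g = B.act p h) : g = h := by
  set T := B.localTriv (B.proj p)
  have hp : p ∈ T.hom.source := T.mem_source.2 (B.mem_localTriv _)
  have := congrArg (fun x => (T.hom x).2) e
  simpa [T.snd_hom _ hp] using this

/-- Two pairs in `P × Q` are equivalent if they are in the same orbit of the action
`g · (p, q) = (p · g⁻¹, g · q)` of `G`. -/
def assocSetoid (Q : Type*) [MulAction G Q] : Setoid (B.Carrier × Q) where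
  r x y := ∃ g : G, y = (B.act x.1 g⁻¹, g • x.2)
  iseqv :=
    { refl := fun x => ⟨1, by simp [act_one]⟩
      symm := by
        rintro ⟨p, q⟩ y ⟨g, rfl⟩
        exact ⟨g⁻¹, by simp [← act_mul, act_one]⟩
      trans := by
        rintro ⟨p, q⟩ y z ⟨g, rfl⟩ ⟨h, rfl⟩
        exact ⟨h * g, by simp [← act_mul, mul_smul]⟩ }

/-- The associated bundle `P ×_G Q`. -/
def Assoc (Q : Type*) [MulAction G Q] : Type _ := Quotient (B.assocSetoid Q)

namespace Assoc

variable {B} {Q : Type*} [MulAction G Q]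

/-- The class `[p, q]`. -/
def mk (p : B.Carrier) (q : Q) : B.Assoc Q := Quotient.mk (B.assocSetoid Q) (p, q)

theorem mk_eq_mk_iff {p p' : B.Carrier} {q q' : Q} :
    (mk p q : B.Assoc Q) = mk p' q' ↔ ∃ g : G, p' = B.act p g⁻¹ ∧ q' = g • q := by
  refine Quotient.eq.trans ?_
  change (∃ g : G, (p', q') = (B.act p g⁻¹, g • q)) ↔ _
  simp only [Prod.mk.injEq]

theorem mk_act (p : B.Carrier) (g : G) (q : Q) : (mk (B.act p g) q : B.Assoc Q) = mk p (g • q) :=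
  mk_eq_mk_iff.2 ⟨g, by simp [← act_mul, act_one], rfl⟩

theorem mk_injective (p : B.Carrier) {q q' : Q} (h : (mk p q : B.Assoc Q) = mk p q') : q = q' := by
  obtain ⟨g, h1, h2⟩ := mk_eq_mk_iff.1 h
  have : (1 : G) = g⁻¹ := B.act_injective p (by rw [act_one]; exact h1)
  rw [h2, inv_eq_one.1 this.symm, one_smul]

theorem ind {C : B.Assoc Q → Prop} (h : ∀ p q, C (mk p q)) (e : B.Assoc Q) : C e :=
  Quotient.ind (fun x => h x.1 x.2) e

/-- The projection of the associated bundle as a function, `[p, q] ↦ ρ(p)`. -/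
noncomputable def projFun : B.Assoc Q → M :=
  Quotient.lift (fun x => B.proj x.1) (by rintro x y ⟨g, rfl⟩; exact (B.proj_act' _ _).symm)

@[simp] theorem projFun_mk (p : B.Carrier) (q : Q) : projFun (mk p q : B.Assoc Q) = B.proj p := rfl

theorem exists_eq_mk {p : B.Carrier} {e : B.Assoc Q} (h : projFun e = B.proj p) :
    ∃ q, e = mk p q := by
  induction e using ind with
  | h p' q =>
    obtain ⟨g, rfl⟩ := B.exists_act_eq (p := p) (p' := p') h.symm
    exact ⟨g • q, mk_act _ _ _⟩

/-- The fibre coordinate of `[p, q]` in a local trivialization. -/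
noncomputable def trivSnd (T : B.LocalTriv) (e : B.Assoc Q) : Q :=
  (T.hom (Quotient.out e).1).2 • (Quotient.out e).2

theorem trivSnd_mk (T : B.LocalTriv) {p : B.Carrier} (hp : p ∈ T.hom.source) (q : Q) :
    trivSnd T (mk p q : B.Assoc Q) = (T.hom p).2 • q := by
  have h : mk p q = mk (Quotient.out (mk p q : B.Assoc Q)).1 (Quotient.out (mk p q : B.Assoc Q)).2 :=
    (Quotient.out_eq (mk p q : B.Assoc Q)).symm
  obtain ⟨g, h1, h2⟩ := mk_eq_mk_iff.1 h
  unfold trivSnd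
  rw [h1, h2, T.snd_hom p hp, smul_smul, mul_assoc, inv_mul_cancel, mul_one]

theorem mk_sec_trivSnd (T : B.LocalTriv) {e : B.Assoc Q} (he : projFun e ∈ T.base) :
    mk (T.sec (projFun e)) (trivSnd T e) = e := by
  induction e using ind with
  | h p q =>
    have hp : p ∈ T.hom.source := T.mem_source.2 he
    rw [trivSnd_mk T hp, projFun_mk, ← mk_act, T.act_sec hp]

section Topology

variable [TopologicalSpace Q]

/-- The quotient topology. -/
instance : TopologicalSpace (B.Assoc Q) :=
  inferInstanceAs (TopologicalSpace (Quotient (B.assocSetoid Q)))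

theorem continuous_mk : Continuous fun x : B.Carrier × Q => (mk x.1 x.2 : B.Assoc Q) :=
  continuous_quot_mk

theorem continuous_projFun : Continuous (projFun : B.Assoc Q → M) :=
  continuous_quot_lift _ (B.proj.contMDiff.continuous.comp continuous_fst)

/-- The local trivialization `[p, q] ↦ (ρ(p), g · q)` of the associated bundle induced by a local
trivialization `p ↦ (ρ(p), g)` of the principal bundle. -/
noncomputable def triv (k : ℕ) [ChartedSpace (𝔼 k) Q] [IsManifold (𝓡 k) ∞ Q]
    [ContMDiffSMul (𝓡 d) (𝓡 k) ∞ G Q] (T : B.LocalTriv) : OpenPartialHomeomorph (B.Assoc Q) (M × Q) where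
  toFun e := (projFun e, trivSnd T e)
  invFun x := mk (T.sec x.1) x.2
  source := projFun ⁻¹' T.base
  target := T.base ×ˢ univ
  map_source' e he := ⟨he, mem_univ _⟩
  map_target' x hx := by
    change projFun (mk _ _) ∈ T.base
    rw [projFun_mk, T.proj_sec hx.1]; exact hx.1
  left_inv' e he := mk_sec_trivSnd T he
  right_inv' x hx := by
    refine Prod.ext (T.proj_sec hx.1) ?_
    change trivSnd T (mk (T.sec x.1) x.2) = x.2
    rw [trivSnd_mk T (T.sec_mem hx.1), T.hom_sec hx.1, one_smul]
  open_source := T.isOpen_base.preimage continuous_projFun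
  open_target := T.isOpen_base.prod isOpen_univ
  continuousOn_toFun := by
    refine continuous_projFun.continuousOn.prodMk ?_
    have hq : Topology.IsQuotientMap (fun x : B.Carrier × Q => (mk x.1 x.2 : B.Assoc Q)) :=
      isQuotientMap_quot_mk
    refine (hq.continuousOn_isOpen_iff (g := trivSnd T)
      (T.isOpen_base.preimage continuous_projFun)).2 ?_
    have hc : ContinuousSMul G Q := ContMDiffSMul.continuousSMul (I := 𝓡 d) (I' := 𝓡 k) ∞
    have h1 : ContinuousOn (fun x : B.Carrier × Q => (T.hom x.1).2 • x.2)
        {x | B.proj x.1 ∈ T.base} := by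
      refine ContinuousOn.smul ?_ continuousOn_snd
      refine continuous_snd.comp_continuousOn
        (T.hom.continuousOn_toFun.comp continuousOn_fst ?_)
      intro x hx
      exact T.mem_source.2 hx
    refine h1.congr ?_
    intro x hx
    exact trivSnd_mk T (T.mem_source.2 hx) x.2
  continuousOn_invFun := by
    have h1 : ContinuousOn (fun x : M × Q => (T.sec x.1, x.2)) (T.base ×ˢ univ) :=
      (T.contMDiffOn_sec.continuousOn.comp continuousOn_fst fun x hx => hx.1).prodMk continuousOn_snd
    exact continuous_mk.comp_continuousOn h1

variable [ChartedSpace (𝔼 k) Q] [IsManifold (𝓡 k) ∞ Q] [ContMDiffSMul (𝓡 d) (𝓡 k) ∞ G Q]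

/-- The transition map between two local trivializations of the associated bundle is smooth. -/
theorem contMDiffOn_triv_triv_symm (T T' : B.LocalTriv) :
    ContMDiffOn ((𝓡 n).prod (𝓡 k)) ((𝓡 n).prod (𝓡 k)) ∞
      (fun x : M × Q => triv k T' (mk (T.sec x.1) x.2)) ((T.base ∩ T'.base) ×ˢ univ) := by
  have hs : ContMDiffOn ((𝓡 n).prod (𝓡 k)) (𝓡 (n + d)) ∞ (fun x : M × Q => T.sec x.1)
      ((T.base ∩ T'.base) ×ˢ univ) :=
    T.contMDiffOn_sec.comp contMDiffOn_fst fun x hx => hx.1.1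
  have hg : ContMDiffOn ((𝓡 n).prod (𝓡 k)) (𝓡 d) ∞ (fun x : M × Q => (T'.hom (T.sec x.1)).2)
      ((T.base ∩ T'.base) ×ˢ univ) :=
    contMDiff_snd.comp_contMDiffOn (T'.contMDiffOn_hom.comp hs fun x hx =>
      T'.mem_source.2 (by rw [T.proj_sec hx.1.1]; exact hx.1.2))
  have h : ContMDiffOn ((𝓡 n).prod (𝓡 k)) ((𝓡 n).prod (𝓡 k)) ∞
      (fun x : M × Q => (x.1, (T'.hom (T.sec x.1)).2 • x.2)) ((T.base ∩ T'.base) ×ˢ univ) :=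
    contMDiffOn_fst.prodMk
      ((contMDiff_smul (I := 𝓡 d) (I' := 𝓡 k)).comp_contMDiffOn (hg.prodMk contMDiffOn_snd))
  refine h.congr fun x hx => Prod.ext (T.proj_sec hx.1.1) ?_
  exact trivSnd_mk T' (T'.mem_source.2 (by rw [T.proj_sec hx.1.1]; exact hx.1.2)) _

/-- The smooth structure of the associated bundle: a chart is a local trivialization followed by a
product of charts of the base manifold and of the typical fibre. -/
noncomputable instance : ChartedSpace (ModelProd (𝔼 n) (𝔼 k)) (B.Assoc Q) where
  atlas := {e | ∃ (T : B.LocalTriv) (z : M × Q),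
    e = (triv k T).trans (chartAt (ModelProd (𝔼 n) (𝔼 k)) z)}
  chartAt e := (triv k (B.localTriv (projFun e))).trans
    (chartAt (ModelProd (𝔼 n) (𝔼 k)) (triv k (B.localTriv (projFun e)) e))
  mem_chart_source e := by
    rw [OpenPartialHomeomorph.trans_source]
    exact ⟨B.mem_localTriv _, mem_chart_source (ModelProd (𝔼 n) (𝔼 k))
      (triv k (B.localTriv (projFun e)) e)⟩
  chart_mem_atlas e := ⟨_, _, rfl⟩

instance : IsManifold ((𝓡 n).prod (𝓡 k)) ∞ (B.Assoc Q) := by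
  have key : ∀ e ∈ atlas (ModelProd (𝔼 n) (𝔼 k)) (B.Assoc Q),
      ∀ e' ∈ atlas (ModelProd (𝔼 n) (𝔼 k)) (B.Assoc Q),
      ContMDiffOn ((𝓡 n).prod (𝓡 k)) ((𝓡 n).prod (𝓡 k)) ∞ (e.symm.trans e')
        (e.symm.trans e').source := by
    rintro _ ⟨T, z, rfl⟩ _ ⟨T', z', rfl⟩
    have h1 := contMDiffOn_chart_symm (I := (𝓡 n).prod (𝓡 k)) (n := ∞) (x := z)
    have h2 := contMDiffOn_chart (I := (𝓡 n).prod (𝓡 k)) (n := ∞) (x := z')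
    have hs : ∀ y ∈ (((triv k T).trans (chartAt (ModelProd (𝔼 n) (𝔼 k)) z)).symm.trans
        ((triv k T').trans (chartAt (ModelProd (𝔼 n) (𝔼 k)) z'))).source,
        y ∈ (chartAt (ModelProd (𝔼 n) (𝔼 k)) z).target ∧
        (chartAt (ModelProd (𝔼 n) (𝔼 k)) z).symm y ∈ (T.base ∩ T'.base) ×ˢ univ ∧
        triv k T' (mk (T.sec ((chartAt (ModelProd (𝔼 n) (𝔼 k)) z).symm y).1)
          ((chartAt (ModelProd (𝔼 n) (𝔼 k)) z).symm y).2) ∈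
          (chartAt (ModelProd (𝔼 n) (𝔼 k)) z').source := by
      intro y hy
      rw [OpenPartialHomeomorph.trans_symm_eq_symm_trans_symm, OpenPartialHomeomorph.trans_source,
        OpenPartialHomeomorph.trans_source, OpenPartialHomeomorph.trans_source] at hy
      obtain ⟨⟨hy1, hy2⟩, hy3, hy4⟩ := hy
      have hb : ((chartAt (ModelProd (𝔼 n) (𝔼 k)) z).symm y).1 ∈ T.base := hy2.1
      refine ⟨hy1, ⟨⟨hb, ?_⟩, mem_univ _⟩, hy4⟩
      have : B.proj (T.sec ((chartAt (ModelProd (𝔼 n) (𝔼 k)) z).symm y).1) ∈ T'.base := hy3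
      rwa [T.proj_sec hb] at this
    exact (h2.comp ((contMDiffOn_triv_triv_symm T T').comp (h1.mono fun y hy => (hs y hy).1)
      fun y hy => (hs y hy).2.1) fun y hy => (hs y hy).2.2)
  refine isManifold_of_contDiffOn _ _ _ fun e e' he he' => ?_
  exact contDiffOn_of_contMDiffOn_model (key e he e' he')

theorem contMDiffOn_triv (T : B.LocalTriv) :
    ContMDiffOn ((𝓡 n).prod (𝓡 k)) ((𝓡 n).prod (𝓡 k)) ∞ (triv k T : B.Assoc Q → M × Q)
      (projFun ⁻¹' T.base) := by
  intro e he
  apply ContMDiffAt.contMDiffWithinAt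
  set T0 := B.localTriv (projFun e) with hT0
  have hc : ContMDiffAt ((𝓡 n).prod (𝓡 k)) ((𝓡 n).prod (𝓡 k)) ∞
      (chartAt (ModelProd (𝔼 n) (𝔼 k)) e) e :=
    contMDiffOn_chart.contMDiffAt (chart_source_mem_nhds _ _)
  set z := triv k T0 e with hz
  have hz1 : z ∈ (T0.base ∩ T.base) ×ˢ univ := ⟨⟨B.mem_localTriv (projFun e), he⟩, mem_univ _⟩
  have hcz : chartAt (ModelProd (𝔼 n) (𝔼 k)) e e = chartAt (ModelProd (𝔼 n) (𝔼 k)) z z := rfl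
  have hs : ContMDiffAt ((𝓡 n).prod (𝓡 k)) ((𝓡 n).prod (𝓡 k)) ∞
      (chartAt (ModelProd (𝔼 n) (𝔼 k)) z).symm (chartAt (ModelProd (𝔼 n) (𝔼 k)) e e) := by
    rw [hcz]
    exact contMDiffOn_chart_symm.contMDiffAt
      ((chartAt (ModelProd (𝔼 n) (𝔼 k)) z).open_target.mem_nhds (mem_chart_target _ z))
  have hzz : (chartAt (ModelProd (𝔼 n) (𝔼 k)) z).symm (chartAt (ModelProd (𝔼 n) (𝔼 k)) e e) = z := by
    rw [hcz]; exact (chartAt (ModelProd (𝔼 n) (𝔼 k)) z).left_inv (mem_chart_source _ z)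
  have ht : ContMDiffAt ((𝓡 n).prod (𝓡 k)) ((𝓡 n).prod (𝓡 k)) ∞
      (fun x : M × Q => triv k T (mk (T0.sec x.1) x.2))
      ((chartAt (ModelProd (𝔼 n) (𝔼 k)) z).symm (chartAt (ModelProd (𝔼 n) (𝔼 k)) e e)) := by
    rw [hzz]
    exact (contMDiffOn_triv_triv_symm T0 T).contMDiffAt
      (((T0.isOpen_base.inter T.isOpen_base).prod isOpen_univ).mem_nhds hz1)
  refine (ht.comp e (hs.comp e hc)).congr_of_eventuallyEq ?_
  filter_upwards [chart_source_mem_nhds (ModelProd (𝔼 n) (𝔼 k)) e] with y hy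
  have hy' := (chartAt (ModelProd (𝔼 n) (𝔼 k)) e).left_inv hy
  exact congrArg (triv k T) hy'.symm

theorem contMDiffOn_triv_symm (T : B.LocalTriv) :
    ContMDiffOn ((𝓡 n).prod (𝓡 k)) ((𝓡 n).prod (𝓡 k)) ∞
      (fun x : M × Q => (mk (T.sec x.1) x.2 : B.Assoc Q)) (T.base ×ˢ univ) := by
  intro x hx
  apply ContMDiffAt.contMDiffWithinAt
  set e : B.Assoc Q := mk (T.sec x.1) x.2 with he
  have hpe : projFun e = x.1 := T.proj_sec hx.1
  set T0 := B.localTriv (projFun e) with hT0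
  have hx0 : x ∈ (T.base ∩ T0.base) ×ˢ (univ : Set Q) :=
    ⟨⟨hx.1, hpe ▸ B.mem_localTriv (projFun e)⟩, mem_univ _⟩
  have ht : ContMDiffAt ((𝓡 n).prod (𝓡 k)) ((𝓡 n).prod (𝓡 k)) ∞
      (fun x : M × Q => triv k T0 (mk (T.sec x.1) x.2)) x :=
    (contMDiffOn_triv_triv_symm T T0).contMDiffAt
      (((T.isOpen_base.inter T0.isOpen_base).prod isOpen_univ).mem_nhds hx0)
  have hc : ContMDiffAt ((𝓡 n).prod (𝓡 k)) ((𝓡 n).prod (𝓡 k)) ∞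
      (chartAt (ModelProd (𝔼 n) (𝔼 k)) (triv k T0 e)) (triv k T0 e) :=
    contMDiffOn_chart.contMDiffAt (chart_source_mem_nhds _ _)
  have hs : ContMDiffAt ((𝓡 n).prod (𝓡 k)) ((𝓡 n).prod (𝓡 k)) ∞
      (chartAt (ModelProd (𝔼 n) (𝔼 k)) e).symm (chartAt (ModelProd (𝔼 n) (𝔼 k)) e e) :=
    contMDiffOn_chart_symm.contMDiffAt
      ((chartAt (ModelProd (𝔼 n) (𝔼 k)) e).open_target.mem_nhds (mem_chart_target _ e))
  refine (hs.comp x (hc.comp x ht)).congr_of_eventuallyEq ?_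
  have hcont : ContinuousAt (fun x : M × Q => (mk (T.sec x.1) x.2 : B.Assoc Q)) x :=
    (triv k T).continuousOn_invFun.continuousAt ((triv k T).open_target.mem_nhds hx)
  filter_upwards [hcont.preimage_mem_nhds (chart_source_mem_nhds (ModelProd (𝔼 n) (𝔼 k)) e)]
    with y hy
  exact ((chartAt (ModelProd (𝔼 n) (𝔼 k)) e).left_inv hy).symm

variable (B Q k) in
/-- The projection of the associated bundle, `[p, q] ↦ ρ(p)`. -/
noncomputable def proj : C^∞⟮(𝓡 n).prod (𝓡 k), B.Assoc Q; 𝓡 n, M⟯ :=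
  ⟨projFun, fun e => ((contMDiff_fst.comp_contMDiffOn
    (contMDiffOn_triv (k := k) (B.localTriv (projFun e)))).contMDiffAt
      (((B.localTriv (projFun e)).isOpen_base.preimage continuous_projFun).mem_nhds
        (B.mem_localTriv _)))⟩

theorem contMDiff_mk : ContMDiff ((𝓡 (n + d)).prod (𝓡 k)) ((𝓡 n).prod (𝓡 k)) ∞
    (fun x : B.Carrier × Q => (mk x.1 x.2 : B.Assoc Q)) := by
  intro x
  set T := B.localTriv (B.proj x.1)
  have hopen : IsOpen {y : B.Carrier × Q | y.1 ∈ T.hom.source} :=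
    T.hom.open_source.preimage continuous_fst
  have hx : x.1 ∈ T.hom.source := T.mem_source.2 (B.mem_localTriv _)
  have h1 : ContMDiffOn ((𝓡 (n + d)).prod (𝓡 k)) ((𝓡 n).prod (𝓡 d)) ∞
      (fun y : B.Carrier × Q => T.hom y.1) {y | y.1 ∈ T.hom.source} :=
    T.contMDiffOn_hom.comp contMDiffOn_fst fun y hy => hy
  have h2 : ContMDiffOn ((𝓡 (n + d)).prod (𝓡 k)) ((𝓡 n).prod (𝓡 k)) ∞
      (fun y : B.Carrier × Q => (B.proj y.1, (T.hom y.1).2 • y.2)) {y | y.1 ∈ T.hom.source} :=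
    ((B.proj.contMDiff.comp contMDiff_fst).contMDiffOn).prodMk
      ((contMDiff_smul (I := 𝓡 d) (I' := 𝓡 k)).comp_contMDiffOn
        ((contMDiff_snd.comp_contMDiffOn h1).prodMk contMDiffOn_snd))
  have h3 := (contMDiffOn_triv_symm (k := k) (Q := Q) T).comp h2
    fun y hy => ⟨T.mem_source.1 hy, mem_univ _⟩
  refine (h3.congr fun y hy => ?_).contMDiffAt (hopen.mem_nhds hx)
  change mk y.1 y.2 = mk (T.sec (B.proj y.1)) ((T.hom y.1).2 • y.2)
  rw [← mk_act, T.act_sec hy]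

end Topology
end Assoc

/-- A gauge transformation, i.e. an element of the group `Gau(P)` of strict automorphisms of the
principal bundle: an equivariant diffeomorphism over the identity of the base. -/
structure GaugeTransformation where
  /-- The underlying diffeomorphism of the total space. -/
  toDiffeomorph : Diffeomorph (𝓡 (n + d)) (𝓡 (n + d)) B.Carrier B.Carrier ∞
  map_act : ∀ (p : B.Carrier) (g : G), toDiffeomorph (B.act p g) = B.act (toDiffeomorph p) g
  proj_map : ∀ p : B.Carrier, B.proj (toDiffeomorph p) = B.proj p

namespace GaugeTransformation

variable {B} {Q : Type*} [MulAction G Q]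

/-- A gauge transformation as a smooth map. -/
noncomputable def toContMDiffMap (f : B.GaugeTransformation) :
    C^∞⟮𝓡 (n + d), B.Carrier; 𝓡 (n + d), B.Carrier⟯ :=
  ⟨f.toDiffeomorph, f.toDiffeomorph.contMDiff⟩

/-- The map induced by a gauge transformation on the associated bundle as a function,
`[p, q] ↦ [f(p), q]`. -/
noncomputable def assocFun (f : B.GaugeTransformation) : B.Assoc Q → B.Assoc Q :=
  Quotient.lift (fun x => Assoc.mk (f.toDiffeomorph x.1) x.2) (by
    rintro x y ⟨g, rfl⟩
    exact Assoc.mk_eq_mk_iff.2 ⟨g, f.map_act _ _, rfl⟩)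

@[simp] theorem assocFun_mk (f : B.GaugeTransformation) (p : B.Carrier) (q : Q) :
    f.assocFun (Assoc.mk p q) = Assoc.mk (f.toDiffeomorph p) q := rfl

theorem projFun_assocFun (f : B.GaugeTransformation) (e : B.Assoc Q) :
    Assoc.projFun (f.assocFun e) = Assoc.projFun e := by
  induction e using Assoc.ind with
  | h p q => exact f.proj_map p

variable [TopologicalSpace Q] [ChartedSpace (𝔼 k) Q] [IsManifold (𝓡 k) ∞ Q]
  [ContMDiffSMul (𝓡 d) (𝓡 k) ∞ G Q]

variable (k Q) in
/-- The strict bundle map of the associated bundle induced by a gauge transformation. -/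
noncomputable def assocMap (f : B.GaugeTransformation) :
    C^∞⟮(𝓡 n).prod (𝓡 k), B.Assoc Q; (𝓡 n).prod (𝓡 k), B.Assoc Q⟯ :=
  ⟨f.assocFun, by
    intro e
    set T := B.localTriv (Assoc.projFun e)
    have h1 := Assoc.contMDiffOn_triv (k := k) (Q := Q) T
    have hs : ContMDiffOn ((𝓡 n).prod (𝓡 k)) (𝓡 (n + d)) ∞
        (fun y : B.Assoc Q => f.toDiffeomorph (T.sec (Assoc.projFun y)))
        (Assoc.projFun ⁻¹' T.base) :=
      f.toDiffeomorph.contMDiff.comp_contMDiffOn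
        (T.contMDiffOn_sec.comp (Assoc.proj k B Q).contMDiff.contMDiffOn fun y hy => hy)
    have h2 := (Assoc.contMDiff_mk (k := k) (B := B) (Q := Q)).comp_contMDiffOn
      (hs.prodMk (contMDiff_snd.comp_contMDiffOn h1))
    refine (h2.congr fun y hy => ?_).contMDiffAt
      ((T.isOpen_base.preimage Assoc.continuous_projFun).mem_nhds (B.mem_localTriv _))
    conv_lhs => rw [← Assoc.mk_sec_trivSnd T hy]
    rfl⟩

end GaugeTransformation
end PrincipalBundle

/-- The typical fibre of the gauge group bundle: the group `G` on which `G` acts by conjugation. -/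
def ConjFibre (G : Type*) : Type _ := G

namespace ConjFibre

instance : TopologicalSpace (ConjFibre G) := inferInstanceAs (TopologicalSpace G)

instance : ChartedSpace (𝔼 d) (ConjFibre G) := inferInstanceAs (ChartedSpace (𝔼 d) G)

instance : Group (ConjFibre G) := inferInstanceAs (Group G)

/-- The identity map from `G` to the typical fibre of the gauge group bundle. -/
def of (g : G) : ConjFibre G := g

/-- The identity map from the typical fibre of the gauge group bundle to `G`. -/
def val (g : ConjFibre G) : G := g

instance : MulAction G (ConjFibre G) where
  smul g h := of (g * val h * g⁻¹)
  one_smul h := show 1 * val h * 1⁻¹ = val h by group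
  mul_smul g g' h := show (g * g') * val h * (g * g')⁻¹ = g * (g' * val h * g'⁻¹) * g⁻¹ by group

theorem smul_of (g h : G) : g • of h = of (g * h * g⁻¹) := rfl

instance : IsManifold (𝓡 d) ∞ (ConjFibre G) := inferInstanceAs (IsManifold (𝓡 d) ∞ G)

instance : ContMDiffSMul (𝓡 d) (𝓡 d) ∞ G (ConjFibre G) where
  contMDiff_smul := by
    have h : ContMDiff ((𝓡 d).prod (𝓡 d)) (𝓡 d) ∞ (fun x : G × G => x.1 * x.2 * x.1⁻¹) :=
      (contMDiff_fst.mul contMDiff_snd).mul contMDiff_fst.inv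
    exact h

end ConjFibre

namespace PrincipalBundle

variable (B : PrincipalBundle n d G M)

/-- The gauge group bundle `P ×_G G`, where `G` acts on itself by conjugation. -/
abbrev GaugeBundle : Type _ := B.Assoc (ConjFibre G)

/-- The projection of the gauge group bundle. -/
noncomputable abbrev gaugeProj : C^∞⟮(𝓡 n).prod (𝓡 d), B.GaugeBundle; 𝓡 n, M⟯ :=
  Assoc.proj d B (ConjFibre G)

open Classical in
/-- The action of the gauge group bundle on the principal bundle,
`[p, g] · (p · g₀) = p · (g g₀)`; in particular `[p, g] · p = p · g`. (If the two arguments do not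
lie over the same point of the base, the value is the second argument.) -/
noncomputable def gaugeAct (γ : B.GaugeBundle) (p : B.Carrier) : B.Carrier :=
  if h : ∃ g : G, γ = Assoc.mk p (ConjFibre.of g) then B.act p h.choose else p

theorem gaugeAct_mk (p : B.Carrier) (g g₀ : G) :
    B.gaugeAct (Assoc.mk p (ConjFibre.of g)) (B.act p g₀) = B.act p (g * g₀) := by
  have e : (Assoc.mk p (ConjFibre.of g) : B.GaugeBundle) =
      Assoc.mk (B.act p g₀) (ConjFibre.of (g₀⁻¹ * g * g₀)) := by
    rw [Assoc.mk_act, ConjFibre.smul_of]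
    congr 2; group
  have h : ∃ g' : G, (Assoc.mk p (ConjFibre.of g) : B.GaugeBundle) =
      Assoc.mk (B.act p g₀) (ConjFibre.of g') := ⟨_, e⟩
  have h2 : h.choose = g₀⁻¹ * g * g₀ :=
    Assoc.mk_injective (B := B) (Q := ConjFibre G) (B.act p g₀) (h.choose_spec.symm.trans e)
  rw [gaugeAct, dif_pos h, h2, ← B.act_mul]
  congr 1; group

open Classical in
/-- The action of the gauge group bundle on an associated bundle, `[p, g] · [p, q] = [p, g · q]`.
(If the two arguments do not lie over the same point of the base, the value is the second
argument.) -/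
noncomputable def gaugeActAssoc {Q : Type*} [MulAction G Q] (γ : B.GaugeBundle) (e : B.Assoc Q) :
    B.Assoc Q :=
  if h : ∃ x : B.Carrier × G × Q, γ = Assoc.mk x.1 (ConjFibre.of x.2.1) ∧ e = Assoc.mk x.1 x.2.2
  then Assoc.mk h.choose.1 (h.choose.2.1 • h.choose.2.2) else e

theorem gaugeActAssoc_mk {Q : Type*} [MulAction G Q] (p : B.Carrier) (g : G) (q : Q) :
    B.gaugeActAssoc (Assoc.mk p (ConjFibre.of g)) (Assoc.mk p q : B.Assoc Q) =
      Assoc.mk p (g • q) := by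
  have h : ∃ x : B.Carrier × G × Q,
      (Assoc.mk p (ConjFibre.of g) : B.GaugeBundle) = Assoc.mk x.1 (ConjFibre.of x.2.1) ∧
      (Assoc.mk p q : B.Assoc Q) = Assoc.mk x.1 x.2.2 := ⟨(p, g, q), rfl, rfl⟩
  rw [gaugeActAssoc, dif_pos h]
  obtain ⟨h1, h2⟩ := h.choose_spec
  generalize h.choose = x at h1 h2
  obtain ⟨a, hp, hg⟩ := Assoc.mk_eq_mk_iff.1 h1
  obtain ⟨b, hp', hq⟩ := Assoc.mk_eq_mk_iff.1 h2
  have hab : a = b := inv_injective (B.act_injective p (hp.symm.trans hp'))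
  subst hab
  have hg' : x.2.1 = a * g * a⁻¹ := hg
  refine Assoc.mk_eq_mk_iff.2 ⟨a⁻¹, ?_, ?_⟩
  · rw [hp, ← B.act_mul]; simp [act_one]
  · rw [hq, hg', smul_smul, smul_smul]
    congr 1; group

end PrincipalBundle
end Bundle

section Jets

variable {n : ℕ} {M : Type*} [TopologicalSpace M] [ChartedSpace (𝔼 n) M] [IsManifold (𝓡 n) ∞ M]
variable {VE HE E VF HF F : Type*} [NormedAddCommGroup VE] [NormedSpace ℝ VE] [TopologicalSpace HE]
  {IE : ModelWithCorners ℝ VE HE} [TopologicalSpace E] [ChartedSpace HE E] [IsManifold IE ∞ E]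
  [NormedAddCommGroup VF] [NormedSpace ℝ VF] [TopologicalSpace HF]
  {IF : ModelWithCorners ℝ VF HF} [TopologicalSpace F] [ChartedSpace HF F] [IsManifold IF ∞ F]

/-- The fibre over `m` of the first order jet bundle of `π : E → M`: points `e` of `E` over `m`
together with a linear map `u : T_m M → T_e E` such that `T_e π ∘ u = id`. (The tangent spaces at
`m` and at `π e = m` are the same space.) -/
structure JetAt (π : C^∞⟮IE, E; 𝓡 n, M⟯) (m : M) where
  pt : E
  proj_pt : π pt = m
  lin : TangentSpace (𝓡 n) m →L[ℝ] TangentSpace IE pt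
  mfderiv_lin : ∀ v : TangentSpace (𝓡 n) m, mfderiv IE (𝓡 n) π pt (lin v) = v

/-- `φ` restricts to a smooth section of `π : E → M` over `U`. -/
structure IsSectionOn (π : C^∞⟮IE, E; 𝓡 n, M⟯) (φ : M → E) (U : Set M) : Prop where
  contMDiffOn : ContMDiffOn (𝓡 n) IE ∞ φ U
  proj_eq : ∀ x ∈ U, π (φ x) = x

/-- The 1-jet at `m` of a local section. -/
noncomputable def IsSectionOn.jet {π : C^∞⟮IE, E; 𝓡 n, M⟯} {φ : M → E} {U : Set M}
    (hφ : IsSectionOn π φ U) (hU : IsOpen U) {m : M} (hm : m ∈ U) : JetAt π m where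
  pt := φ m
  proj_pt := hφ.proj_eq m hm
  lin := mfderiv (𝓡 n) IE φ m
  mfderiv_lin v := by
    have h1 : MDifferentiableAt (𝓡 n) IE φ m :=
      (hφ.contMDiffOn.contMDiffAt (hU.mem_nhds hm)).mdifferentiableAt (by simp)
    have h2 : MDifferentiableAt IE (𝓡 n) π (φ m) := π.contMDiff.mdifferentiableAt (by simp)
    have h3 : (π ∘ φ) =ᶠ[𝓝 m] id := by
      filter_upwards [hU.mem_nhds hm] with x hx using hφ.proj_eq x hx
    have h4 : mfderiv (𝓡 n) (𝓡 n) (π ∘ φ) m = ContinuousLinearMap.id ℝ _ := by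
      rw [h3.mfderiv_eq]; exact mfderiv_id
    rw [mfderiv_comp m h2 h1] at h4
    exact congrArg (fun L => L v) h4

namespace JetAt

variable {π : C^∞⟮IE, E; 𝓡 n, M⟯} {π' : C^∞⟮IF, F; 𝓡 n, M⟯} {m : M}

/-- The jet prolongation of a strict bundle map `f : E → F`, `(e, u) ↦ (f(e), T_e f ∘ u)`. -/
noncomputable def map (f : C^∞⟮IE, E; IF, F⟯) (hf : ∀ e, π' (f e) = π e) (j : JetAt π m) :
    JetAt π' m where
  pt := f j.pt
  proj_pt := (hf j.pt).trans j.proj_pt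
  lin := (mfderiv IE IF f j.pt).comp j.lin
  mfderiv_lin v := by
    have h1 : MDifferentiableAt IE IF f j.pt := f.contMDiff.mdifferentiableAt (by simp)
    have h2 : MDifferentiableAt IF (𝓡 n) π' (f j.pt) := π'.contMDiff.mdifferentiableAt (by simp)
    have h3 : π' ∘ f = π := funext hf
    have h4 := mfderiv_comp j.pt h2 h1
    rw [h3] at h4
    have h5 := j.mfderiv_lin v
    rw [h4] at h5
    exact h5

theorem map_id (f : C^∞⟮IE, E; IE, E⟯) (hf : ∀ e, π (f e) = π e) (h : ∀ e, f e = e)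
    (j : JetAt π m) : j.map f hf = j := by
  obtain rfl : f = ContMDiffMap.id := ContMDiffMap.ext h
  have h' : mfderiv IE IE (ContMDiffMap.id : C^∞⟮IE, E; IE, E⟯) j.pt =
      ContinuousLinearMap.id ℝ (TangentSpace IE j.pt) := mfderiv_id
  obtain ⟨e, he, u, hu⟩ := j
  simp only [map] at h' ⊢
  congr 1
  rw [h']
  rfl

theorem map_map (f : C^∞⟮IE, E; IE, E⟯) (hf : ∀ e, π (f e) = π e) (g : C^∞⟮IE, E; IE, E⟯)
    (hg : ∀ e, π (g e) = π e) (k : C^∞⟮IE, E; IE, E⟯) (hk : ∀ e, π (k e) = π e)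
    (h : ∀ e, k e = g (f e)) (j : JetAt π m) : (j.map f hf).map g hg = j.map k hk := by
  obtain rfl : k = g.comp f := ContMDiffMap.ext h
  have h' : mfderiv IE IE (g.comp f) j.pt =
      (mfderiv IE IE g (f j.pt)).comp (mfderiv IE IE f j.pt) :=
    mfderiv_comp j.pt (g.contMDiff.mdifferentiableAt (by simp))
      (f.contMDiff.mdifferentiableAt (by simp))
  obtain ⟨e, he, u, hu⟩ := j
  simp only [map] at h' ⊢
  congr 1
  rw [h']
  rfl

end JetAt

/-- The total space of the first order jet bundle of `π : E → M`. -/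
def JetBundle (π : C^∞⟮IE, E; 𝓡 n, M⟯) : Type _ := Σ m : M, JetAt π m

noncomputable instance (π : C^∞⟮IE, E; 𝓡 n, M⟯) (e : E) :
    AddCommGroup ((π *ᵖ (TangentSpace (𝓡 n) : M → Type)) e) :=
  inferInstanceAs (AddCommGroup (TangentSpace (𝓡 n) (π e)))

/-- The vector bundle `Hom(π^* TM, TE)` over `E`. -/
abbrev HomBundle (π : C^∞⟮IE, E; 𝓡 n, M⟯) : Type _ :=
  Bundle.TotalSpace (𝔼 n →L[ℝ] VE)
    (fun e : E => (π *ᵖ (TangentSpace (𝓡 n) : M → Type)) e →L[ℝ] TangentSpace IE e)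

/-- The inclusion of the jet bundle in `Hom(π^* TM, TE)`. -/
def JetBundle.toHom {π : C^∞⟮IE, E; 𝓡 n, M⟯} (j : JetBundle π) : HomBundle π :=
  ⟨j.2.pt, j.2.lin⟩

/-- The jet bundle carries the topology of a subspace of `Hom(π^* TM, TE)`. -/
noncomputable instance (π : C^∞⟮IE, E; 𝓡 n, M⟯) : TopologicalSpace (JetBundle π) :=
  TopologicalSpace.induced JetBundle.toHom inferInstance

variable {π : C^∞⟮IE, E; 𝓡 n, M⟯}

/-- A global smooth section of `π : E → M`. -/
structure GlobalSection (π : C^∞⟮IE, E; 𝓡 n, M⟯) where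
  toFun : M → E
  isSectionOn : IsSectionOn π toFun univ

/-- The 1-jet at `m` of a global section. -/
noncomputable def GlobalSection.jet (φ : GlobalSection π) (m : M) : JetAt π m :=
  φ.isSectionOn.jet isOpen_univ (mem_univ m)

/-- The section `f ∘ φ` obtained from `φ` by applying a strict bundle map `f`. -/
noncomputable def GlobalSection.map (f : C^∞⟮IE, E; IE, E⟯) (hf : ∀ e, π (f e) = π e) (φ : GlobalSection π) :
    GlobalSection π where
  toFun m := f (φ.toFun m)
  isSectionOn :=
    ⟨f.contMDiff.comp_contMDiffOn φ.isSectionOn.contMDiffOn,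
      fun x hx => (hf _).trans (φ.isSectionOn.proj_eq x hx)⟩

/-- The action of 1-jets of local sections of a bundle `𝒢` on 1-jets of local sections of a bundle
`E` over the same base that is induced by an action of `𝒢` on `E`: one has `b' = a · b` if
`a = j_m γ`, `b = j_m φ` and `b' = j_m (γ · φ)` for some smooth sections `γ` of `𝒢` and `φ` of `E`
over a neighbourhood of `m`, where `γ · φ` is formed pointwise. -/
def JetActs {π𝒢 : C^∞⟮IF, F; 𝓡 n, M⟯} (act : F → E → E) {m : M} (a : JetAt π𝒢 m)
    (b b' : JetAt π m) : Prop :=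
  ∃ (U : Set M) (hU : IsOpen U) (hm : m ∈ U) (γ : M → F) (φ : M → E)
    (hγ : IsSectionOn π𝒢 γ U) (hφ : IsSectionOn π φ U)
    (hγφ : IsSectionOn π (fun x => act (γ x) (φ x)) U),
    hγ.jet hU hm = a ∧ hφ.jet hU hm = b ∧ hγφ.jet hU hm = b'

end Jets

section Forms

variable (n : ℕ) (M : Type*) [TopologicalSpace M] [ChartedSpace (𝔼 n) M] [IsManifold (𝓡 n) ∞ M]

/-- The fibre `⋀ⁿ T_m^* M` of the bundle of `n`-forms on the `n`-dimensional manifold `M`. -/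
abbrev TopFormAt (m : M) : Type := TangentSpace (𝓡 n) m [⋀^Fin n]→L[ℝ] Bundle.Trivial M ℝ m

/-- The total space of the bundle `⋀ⁿ T^* M`, with its usual topology. -/
abbrev TopFormBundle : Type _ :=
  Bundle.TotalSpace (𝔼 n [⋀^Fin n]→L[ℝ] ℝ) (fun m : M => TopFormAt n M m)

/-- The chosen atlas of `M` is oriented: all changes of coordinates have positive Jacobian. -/
class OrientedAtlas : Prop where
  det_pos : ∀ x y z : M, z ∈ (chartAt (𝔼 n) x).source → z ∈ (chartAt (𝔼 n) y).source →
    0 < (tangentCoordChange (𝓡 n) x y z).det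

variable {n M}

/-- The coordinate vectors `∂/∂x¹, …, ∂/∂xⁿ` at `m` of the chart around `x`. -/
noncomputable def coordVec (x m : M) (i : Fin n) : TangentSpace (𝓡 n) m :=
  (trivializationAt (𝔼 n) (TangentSpace (𝓡 n)) x).symm m (EuclideanSpace.single i 1)

variable [T2Space M] [SigmaCompactSpace M]

variable (n M) in
/-- A smooth partition of unity subordinate to the cover of `M` by chart domains. -/
noncomputable def chartPartition : SmoothPartitionOfUnity M (𝓡 n) M univ :=
  (SmoothPartitionOfUnity.exists_isSubordinate_chartAt_source (𝓡 n) M).choose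

/-- The integral `∫_K ω` of an `n`-form on an oriented `n`-dimensional manifold over a subset `K`,
computed in the oriented charts by means of a subordinate partition of unity. -/
noncomputable def integralForm [OrientedAtlas n M] (K : Set M) (η : ∀ m : M, TopFormAt n M m) : ℝ :=
  ∑ᶠ i : M, ∫ y in (chartAt (𝔼 n) i).target ∩ (chartAt (𝔼 n) i).symm ⁻¹' K,
    chartPartition n M i ((chartAt (𝔼 n) i).symm y) *
      η ((chartAt (𝔼 n) i).symm y) (coordVec i ((chartAt (𝔼 n) i).symm y))

end Forms

section GaugeInvariance

variable {n d k : ℕ} {G M : Type*}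
  [TopologicalSpace G] [ChartedSpace (𝔼 d) G] [Group G] [LieGroup (𝓡 d) ∞ G]
  [TopologicalSpace M] [ChartedSpace (𝔼 n) M] [IsManifold (𝓡 n) ∞ M]

namespace PrincipalBundle

variable (B : PrincipalBundle n d G M)

/-- The right translation by `g ∈ G` on the principal bundle. -/
noncomputable def rightTranslation (g : G) :
    C^∞⟮𝓡 (n + d), B.Carrier; 𝓡 (n + d), B.Carrier⟯ :=
  ⟨fun p => B.act p g, B.contMDiff_act'.comp (contMDiff_id.prodMk contMDiff_const)⟩

/-- Two points of `JP` over `m` are equivalent if they are in the same orbit of the right action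
of `G` on `JP` which is induced by the right action of `G` on `P`. -/
def connectionSetoid (m : M) : Setoid (JetAt B.proj m) where
  r w w' := ∃ g : G, w' = w.map (B.rightTranslation g) (fun p => B.proj_act' p g)
  iseqv :=
    { refl := fun w => ⟨1, (JetAt.map_id _ _ B.act_one w).symm⟩
      symm := by
        rintro w _ ⟨g, rfl⟩
        refine ⟨g⁻¹, ?_⟩
        refine ((JetAt.map_map _ _ _ _ (B.rightTranslation 1) (fun p => B.proj_act' p 1)
          (fun p => ?_) w).trans (JetAt.map_id _ _ B.act_one w)).symm
        change B.act p 1 = B.act (B.act p g) g⁻¹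
        rw [← B.act_mul, mul_inv_cancel]
      trans := by
        rintro w _ _ ⟨g, rfl⟩ ⟨h, rfl⟩
        exact ⟨g * h, JetAt.map_map _ _ _ _ _ _ (fun p => B.act_mul p g h) w⟩ }

/-- The fibre over `m` of the connection bundle `CP = JP / G`. -/
def ConnectionAt (m : M) : Type _ := Quotient (B.connectionSetoid m)

variable {B}

/-- The class `[w]` in `CP` of an element `w` of `JP`. -/
def ConnectionAt.mk {m : M} (w : JetAt B.proj m) : B.ConnectionAt m :=
  Quotient.mk (B.connectionSetoid m) w

variable (B)

/-- The total space of the connection bundle `CP = JP / G`. -/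
def ConnectionBundle : Type _ := Σ m : M, B.ConnectionAt m

/-- The projection `JP → CP`. -/
def toConnectionBundle (w : JetBundle B.proj) : B.ConnectionBundle := ⟨w.1, ConnectionAt.mk w.2⟩

/-- The connection bundle carries the quotient topology. -/
noncomputable instance : TopologicalSpace B.ConnectionBundle :=
  TopologicalSpace.coinduced B.toConnectionBundle inferInstance

/-- A smooth section of the connection bundle, i.e. a principal connection: a section which locally
lifts to a smooth section of `JP`, where a section `w` of `JP` is smooth if the corresponding
fibrewise linear map `TM → TP` is. -/
structure Connection where
  toFun : ∀ m : M, B.ConnectionAt m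
  smooth : ∀ m : M, ∃ U : Set M, IsOpen U ∧ m ∈ U ∧ ∃ w : ∀ x : M, JetAt B.proj x,
    (∀ x ∈ U, toFun x = ConnectionAt.mk (w x)) ∧
    ContMDiffOn (𝓡 n).tangent (𝓡 (n + d)).tangent ∞
      (fun v : TangentBundle (𝓡 n) M =>
        (⟨(w v.1).pt, (w v.1).lin v.2⟩ : TangentBundle (𝓡 (n + d)) B.Carrier))
      (Bundle.TotalSpace.proj ⁻¹' U)

variable {B}

/-- The action of a gauge transformation `f` on `JP`, `j_m σ ↦ j_m (f ∘ σ)`. -/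
noncomputable def GaugeTransformation.jetMap (f : B.GaugeTransformation) {m : M}
    (w : JetAt B.proj m) : JetAt B.proj m :=
  w.map f.toContMDiffMap f.proj_map

/-- The action of a gauge transformation `f` on `CP`, `[j_m σ] ↦ [j_m (f ∘ σ)]`. -/
noncomputable def GaugeTransformation.connectionMap (f : B.GaugeTransformation) {m : M} :
    B.ConnectionAt m → B.ConnectionAt m :=
  Quotient.map' (s₁ := B.connectionSetoid m) (s₂ := B.connectionSetoid m) f.jetMap (by
    rintro w _ ⟨g, rfl⟩
    have hk : ∀ p, B.proj ((f.toContMDiffMap.comp (B.rightTranslation g)) p) = B.proj p :=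
      fun p => (f.proj_map _).trans (B.proj_act' p g)
    have h1 : (w.map (B.rightTranslation g) (fun p => B.proj_act' p g)).map f.toContMDiffMap
        f.proj_map = w.map (f.toContMDiffMap.comp (B.rightTranslation g)) hk :=
      JetAt.map_map _ _ _ _ _ _ (fun p => rfl) w
    have h2 : (w.map f.toContMDiffMap f.proj_map).map (B.rightTranslation g)
        (fun p => B.proj_act' p g) = w.map (f.toContMDiffMap.comp (B.rightTranslation g)) hk :=
      JetAt.map_map _ _ _ _ _ _ (fun p => f.map_act p g) w
    exact ⟨g, h1.trans h2.symm⟩)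

/-- The action of a gauge transformation on principal connections. -/
noncomputable def GaugeTransformation.mapConnection (f : B.GaugeTransformation)
    (A : B.Connection) : B.Connection where
  toFun m := f.connectionMap (A.toFun m)
  smooth m := by
    obtain ⟨U, hU, hm, w, h1, h2⟩ := A.smooth m
    refine ⟨U, hU, hm, fun x => f.jetMap (w x), fun x hx => by rw [h1 x hx]; rfl, ?_⟩
    have h3 := f.toContMDiffMap.contMDiff.contMDiff_tangentMap (m := ∞) (by simp)
    exact h3.comp_contMDiffOn h2

variable (B) (k) (Q : Type*) [MulAction G Q] [TopologicalSpace Q] [ChartedSpace (𝔼 k) Q]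
  [IsManifold (𝓡 k) ∞ Q] [ContMDiffSMul (𝓡 d) (𝓡 k) ∞ G Q]

/-- The projection of the matter field bundle `P ×_G Q`. -/
noncomputable abbrev matterProj : C^∞⟮(𝓡 n).prod (𝓡 k), B.Assoc Q; 𝓡 n, M⟯ :=
  Assoc.proj k B Q

/-- The fibre product `CP ×_M J(P ×_G Q)`. -/
def CoupledBundle : Type _ := Σ m : M, B.ConnectionAt m × JetAt (B.matterProj k Q) m

/-- The fibre product carries the topology of a subspace of `CP × J(P ×_G Q)`. -/
noncomputable instance : TopologicalSpace (B.CoupledBundle k Q) :=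
  TopologicalSpace.induced
    (fun z => ((⟨z.1, z.2.1⟩, ⟨z.1, z.2.2⟩) : B.ConnectionBundle × JetBundle (B.matterProj k Q)))
    inferInstance

/-- A matter field Lagrangian `L : J(P ×_G Q) → ⋀ⁿ T^* M`: a continuous map over `M`. -/
structure MatterLagrangian where
  toFun : ∀ m : M, JetAt (B.matterProj k Q) m → TopFormAt n M m
  continuous : Continuous
    (fun j : JetBundle (B.matterProj k Q) => (⟨j.1, toFun j.1 j.2⟩ : TopFormBundle n M))

/-- A matter field Lagrangian `L : CP ×_M J(P ×_G Q) → ⋀ⁿ T^* M`: a continuous map over `M`. -/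
structure CoupledLagrangian where
  toFun : ∀ m : M, B.ConnectionAt m → JetAt (B.matterProj k Q) m → TopFormAt n M m
  continuous : Continuous
    (fun z : B.CoupledBundle k Q => (⟨z.1, toFun z.1 z.2.1 z.2.2⟩ : TopFormBundle n M))

variable {B k Q}

/-- The action of a gauge transformation on global sections of `P ×_G Q`. -/
noncomputable def GaugeTransformation.mapSection (f : B.GaugeTransformation)
    (φ : GlobalSection (B.matterProj k Q)) : GlobalSection (B.matterProj k Q) :=
  φ.map (f.assocMap k Q) f.projFun_assocFun

/-- The action of `J(P ×_G G)` on `CP = JP / G` induced by its action on `JP`: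
one has `A' = a · A` if `A = [w]` and `A' = [a · w]`. -/
def ConnectionActs {m : M} (a : JetAt B.gaugeProj m) (A A' : B.ConnectionAt m) : Prop :=
  ∃ w w' : JetAt B.proj m, JetActs B.gaugeAct a w w' ∧
    A = ConnectionAt.mk w ∧ A' = ConnectionAt.mk w'

namespace MatterLagrangian

variable (L : B.MatterLagrangian k Q)

/-- Invariance of the Lagrangian under the action of the derived gauge group bundle `J(P ×_G G)`
on `J(P ×_G Q)`. -/
def IsInvariant : Prop :=
  ∀ (m : M) (a : JetAt B.gaugeProj m) (b b' : JetAt (B.matterProj k Q) m),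
    JetActs B.gaugeActAssoc a b b' → L.toFun m b' = L.toFun m b

variable [T2Space M] [SigmaCompactSpace M] [OrientedAtlas n M]

/-- The action functional `S_K[φ] = ∫_K L(φ, ∂φ)`. -/
noncomputable def action (K : Set M) (φ : GlobalSection (B.matterProj k Q)) : ℝ :=
  integralForm K (fun m => L.toFun m (φ.jet m))

/-- Gauge invariance: the action functionals over all compact sets are invariant under `Gau(P)`. -/
def IsGaugeInvariant : Prop :=
  ∀ K : Set M, IsCompact K → ∀ (f : B.GaugeTransformation) (φ : GlobalSection (B.matterProj k Q)),
    L.action K (f.mapSection φ) = L.action K φ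

end MatterLagrangian

namespace CoupledLagrangian

variable (L : B.CoupledLagrangian k Q)

/-- Invariance of the Lagrangian under the combined action of the derived gauge group bundle
`J(P ×_G G)` on `CP ×_M J(P ×_G Q)`. -/
def IsInvariant : Prop :=
  ∀ (m : M) (a : JetAt B.gaugeProj m) (A A' : B.ConnectionAt m)
    (b b' : JetAt (B.matterProj k Q) m),
    ConnectionActs a A A' → JetActs B.gaugeActAssoc a b b' → L.toFun m A' b' = L.toFun m A b

variable [T2Space M] [SigmaCompactSpace M] [OrientedAtlas n M]

/-- The action functional `S_K[A, φ] = ∫_K L(A, φ, ∂φ)`. -/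
noncomputable def action (K : Set M) (A : B.Connection) (φ : GlobalSection (B.matterProj k Q)) :
    ℝ :=
  integralForm K (fun m => L.toFun m (A.toFun m) (φ.jet m))

/-- Gauge invariance: the action functionals over all compact sets are invariant under `Gau(P)`. -/
def IsGaugeInvariant : Prop :=
  ∀ K : Set M, IsCompact K → ∀ (f : B.GaugeTransformation) (A : B.Connection)
    (φ : GlobalSection (B.matterProj k Q)),
    L.action K (f.mapConnection A) (f.mapSection φ) = L.action K A φ

end CoupledLagrangian

end PrincipalBundle
end GaugeInvariance
end GaugeTheory

/-! A gauge transformation f is the same as a global section γ of the gauge group bundle: f(p) = p ·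
g(p) with g(p · h) = h⁻¹ g(p) h, and γ(ρ(p)) = [p, g(p)]. The jet of f ∘ φ at m is therefore the jet
of γ at m acting on the jet of φ at m (`jetActs_mapSection`), and likewise on JP (`jetActs_jetMap`,
where `exists_isSectionOn_jet_eq` represents a point of JP by a local section). An invariant
Lagrangian thus gives the same integrand for the original and the transformed fields, hence the same
integrals.

Conversely, the integrands are continuous n-forms, because jet prolongations and connections are
continuous. On an oriented manifold such forms are determined by their integrals over compact sets
(`form_eq_of_integralForm_eq`), so gauge invariance yields pointwise equality of the integrands at
jets of global fields. It remains to reach arbitrary jets. An acting jet and the jet it acts on are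
represented by local sections, and the germs of these have to be extended to global sections. The
only obstruction is the component of the fibre: the values at m taken by global sections form a
clopen set, because inside a chart ball of the typical fibre a global section can be interpolated
with a local one by a bump function. As every component is met, every germ extends
(`exists_globalSection_eventuallyEq`). Applied to the gauge group bundle, this extends germs of its
sections to gauge transformations (`exists_gaugeTransformation_eventually_eq`).

The coupled case has two further ingredients. Every jet of a local section of P represents the value
at m of some global principal connection, obtained by gluing flat connections with a partition of
unity (`exists_connection_eq_mk_jet`). The actions on CP and on the matter jets may use different
local representatives of the same gauge jet, so the action on matter jets has to be well defined
(`jetActs_gaugeActAssoc_unique`). -/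

namespace GaugeTheory

/-! ### Continuous forms of top degree and their integrals over compact sets -/

section Forms

open MeasureTheory

variable {n : ℕ} {M : Type*} [TopologicalSpace M] [ChartedSpace (𝔼 n) M] [IsManifold (𝓡 n) ∞ M]

/-- The tangent space at m is the model space read through the preferred chart at m. The coordinate
vectors of another chart are therefore the standard basis transported by the derivative of the
coordinate change. -/
theorem coordVec_eq_tangentCoordChange {x m : M} (hm : m ∈ (chartAt (𝔼 n) x).source) (i : Fin n) :
    @Eq (𝔼 n) (coordVec x m i) (tangentCoordChange (𝓡 n) x m m (EuclideanSpace.single i 1)) := by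
  have h := TangentBundle.symmL_trivializationAt_eq_core (I := 𝓡 n) hm
  have h' : @Eq (𝔼 n →L[ℝ] 𝔼 n)
    ((trivializationAt (𝔼 n) (TangentSpace (𝓡 n)) x).symmL ℝ m) (tangentCoordChange (𝓡 n) x m m) := h
  exact ((trivializationAt (𝔼 n) (TangentSpace (𝓡 n)) x).symmL_apply (R := ℝ) hm _).symm.trans
    (congrArg (fun L : 𝔼 n →L[ℝ] 𝔼 n => L (EuclideanSpace.single i 1)) h')

theorem coordVec_self (m : M) (i : Fin n) :
    @Eq (𝔼 n) (coordVec m m i) (EuclideanSpace.single i 1) :=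
  (coordVec_eq_tangentCoordChange (mem_chart_source _ m) i).trans
    (tangentCoordChange_self (I := 𝓡 n) (mem_extChartAt_source m))

/-- An alternating form of top degree composed with a linear map is multiplied by its
determinant. -/
theorem alternating_comp_eq_det_mul (α : 𝔼 n [⋀^Fin n]→L[ℝ] ℝ) (A : 𝔼 n →L[ℝ] 𝔼 n) (v : Fin n → 𝔼 n) :
    α (fun i => A (v i)) = A.det * α v := by
  have h := (α.toAlternatingMap).eq_smul_basis_det (EuclideanSpace.basisFun (Fin n) ℝ).toBasis
  have h1 : ∀ w, α w = α (EuclideanSpace.basisFun (Fin n) ℝ).toBasis *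
      (EuclideanSpace.basisFun (Fin n) ℝ).toBasis.det w := fun w =>
    congrArg (fun f => f w) h
  rw [h1, h1 v]
  have h2 := (EuclideanSpace.basisFun (Fin n) ℝ).toBasis.det_comp (A : 𝔼 n →ₗ[ℝ] 𝔼 n) v
  have h3 : (EuclideanSpace.basisFun (Fin n) ℝ).toBasis.det (fun i => A (v i)) = A.det *
      (EuclideanSpace.basisFun (Fin n) ℝ).toBasis.det v := h2
  rw [h3]; ring

/-- By the cocycle identity both coordinate frames pass through the chart at y, so the factor is a
determinant on one fixed model space. Its positivity in an oriented atlas makes the sign of a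
density independent of the chart. -/
theorem form_coordVec_eq_det_mul {x y z : M} (hx : z ∈ (chartAt (𝔼 n) x).source)
    (hy : z ∈ (chartAt (𝔼 n) y).source) (α : TopFormAt n M z) :
    α (coordVec x z) = (tangentCoordChange (𝓡 n) x y z).det * (α (coordVec y z) : ℝ) := by
  have h1 : @Eq (Fin n → 𝔼 n) (coordVec x z) fun i => tangentCoordChange (𝓡 n) y z z
      (tangentCoordChange (𝓡 n) x y z (EuclideanSpace.single i 1)) := by
    funext i
    refine (coordVec_eq_tangentCoordChange hx i).trans
      (tangentCoordChange_comp (I := 𝓡 n) ⟨⟨?_, ?_⟩, mem_extChartAt_source z⟩).symm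
    · rwa [extChartAt_source]
    · rwa [extChartAt_source]
  have h2 : @Eq (Fin n → 𝔼 n) (coordVec y z) fun i => tangentCoordChange (𝓡 n) y z z (EuclideanSpace.single i 1) :=
    funext fun i => coordVec_eq_tangentCoordChange hy i
  refine (congrArg (α : 𝔼 n [⋀^Fin n]→L[ℝ] ℝ) h1).trans (Eq.trans ?_
    (congrArg (fun v => _ * (α : 𝔼 n [⋀^Fin n]→L[ℝ] ℝ) v) h2.symm))
  exact alternating_comp_eq_det_mul
    (ContinuousAlternatingMap.compContinuousLinearMap (α : 𝔼 n [⋀^Fin n]→L[ℝ] ℝ)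
      (tangentCoordChange (𝓡 n) y z z))
    (tangentCoordChange (𝓡 n) x y z) (fun i => EuclideanSpace.single i 1)

/-- Top degree forms are a one-dimensional space: a form is a multiple of the determinant, with its
value on a basis as the factor. In the chart at m itself the coordinate frame is the standard basis.
-/
theorem form_eq_of_coordVec_eq {m : M} {α β : TopFormAt n M m}
    (h : α (coordVec m m) = β (coordVec m m)) : α = β := by
  have hv : @Eq (Fin n → 𝔼 n) (coordVec m m) (EuclideanSpace.basisFun (Fin n) ℝ).toBasis := by
    funext i
    exact (coordVec_self m i).trans (by simp)
  have h : (α : 𝔼 n [⋀^Fin n]→L[ℝ] ℝ) (EuclideanSpace.basisFun (Fin n) ℝ).toBasis =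
      (β : 𝔼 n [⋀^Fin n]→L[ℝ] ℝ) (EuclideanSpace.basisFun (Fin n) ℝ).toBasis :=
    (congrArg (α : 𝔼 n [⋀^Fin n]→L[ℝ] ℝ) hv.symm).trans
      (h.trans (congrArg (β : 𝔼 n [⋀^Fin n]→L[ℝ] ℝ) hv))
  apply ContinuousAlternatingMap.toAlternatingMap_injective
  have e1 := (ContinuousAlternatingMap.toAlternatingMap
    (α : 𝔼 n [⋀^Fin n]→L[ℝ] ℝ)).eq_smul_basis_det (EuclideanSpace.basisFun (Fin n) ℝ).toBasis
  have e2 := (ContinuousAlternatingMap.toAlternatingMap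
    (β : 𝔼 n [⋀^Fin n]→L[ℝ] ℝ)).eq_smul_basis_det (EuclideanSpace.basisFun (Fin n) ℝ).toBasis
  refine e1.trans (Eq.trans ?_ e2.symm)
  exact congrArg (fun c : ℝ => c • (EuclideanSpace.basisFun (Fin n) ℝ).toBasis.det) h

/-- The coefficient function of a continuous form in a chart is continuous. -/
theorem continuousOn_form_coordVec {η : ∀ m : M, TopFormAt n M m}
    (hη : Continuous fun m => (⟨m, η m⟩ : TopFormBundle n M)) (x : M) :
    ContinuousOn (fun m => (η m (coordVec x m) : ℝ)) (chartAt (𝔼 n) x).source := by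
  intro m hm
  apply ContinuousAt.continuousWithinAt
  set e := trivializationAt (𝔼 n [⋀^Fin n]→L[ℝ] ℝ) (fun m : M => TopFormAt n M m) x with he
  have hbase : m ∈ e.baseSet := ⟨hm, mem_univ _⟩
  have h1 : ContinuousAt (fun y => (e ⟨y, η y⟩).2) m :=
    (continuous_snd.continuousAt.comp
      (e.continuousAt (e.mem_source.2 hbase))).comp (f := fun y => (⟨y, η y⟩ : TopFormBundle n M))
        hη.continuousAt
  have h2 : Continuous fun α : 𝔼 n [⋀^Fin n]→L[ℝ] ℝ => α (fun i => EuclideanSpace.single i 1) :=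
    ContinuousEvalConst.continuous_eval_const _
  refine (h2.continuousAt.comp h1).congr ?_
  filter_upwards [(chartAt (𝔼 n) x).open_source.mem_nhds hm] with y hy
  -- In the trivialization of the form bundle around x, a form is precomposed with the inverse
  -- tangent trivialization. Evaluation at the standard basis thus gives exactly the coefficient in
  -- the chart.
  have h3 : coordVec x y = fun i =>
      (trivializationAt (𝔼 n) (TangentSpace (𝓡 n)) x).symmL ℝ y (EuclideanSpace.single i 1) :=
    funext fun i => ((trivializationAt (𝔼 n) (TangentSpace (𝓡 n)) x).symmL_apply (R := ℝ) hy _).symm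
  rw [h3]
  have h4 : ∀ c : ℝ, (trivializationAt ℝ (Bundle.Trivial M ℝ) x).continuousLinearMapAt ℝ y c = c := by
    intro c
    simp
  exact h4 _

variable [T2Space M] [SigmaCompactSpace M] [OrientedAtlas n M]

/-- The integrand of `integralForm` in the chart around `i`. -/
noncomputable def formDensity (η : ∀ m : M, TopFormAt n M m) (i : M) (y : 𝔼 n) : ℝ :=
  chartPartition n M i ((chartAt (𝔼 n) i).symm y) *
    η ((chartAt (𝔼 n) i).symm y) (coordVec i ((chartAt (𝔼 n) i).symm y))

theorem chartPartition_subordinate (i : M) :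
    tsupport (chartPartition n M i) ⊆ (chartAt (𝔼 n) i).source :=
  (SmoothPartitionOfUnity.exists_isSubordinate_chartAt_source (𝓡 n) M).choose_spec i

theorem continuousOn_formDensity {η : ∀ m : M, TopFormAt n M m}
    (hη : Continuous fun m => (⟨m, η m⟩ : TopFormBundle n M)) (i : M) :
    ContinuousOn (formDensity η i) (chartAt (𝔼 n) i).target := by
  have hs := (chartAt (𝔼 n) i).continuousOn_symm
  exact ((chartPartition n M i).contMDiff.continuous.comp_continuousOn hs).mul
    ((continuousOn_form_coordVec hη i).comp hs fun y hy => (chartAt (𝔼 n) i).map_target hy)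

theorem measurableSet_chart_preimage {K : Set M} (hK : IsCompact K) (i : M) :
    MeasurableSet ((chartAt (𝔼 n) i).target ∩ (chartAt (𝔼 n) i).symm ⁻¹' K) := by
  have h := (chartAt (𝔼 n) i).symm.isOpen_inter_preimage hK.isClosed.isOpen_compl
  have e : (chartAt (𝔼 n) i).target ∩ (chartAt (𝔼 n) i).symm ⁻¹' K =
      (chartAt (𝔼 n) i).target \ ((chartAt (𝔼 n) i).target ∩ (chartAt (𝔼 n) i).symm ⁻¹' Kᶜ) := by
    ext y; simp +contextual
  rw [e]
  exact (chartAt (𝔼 n) i).open_target.measurableSet.diff h.measurableSet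

/-- The chart preimage of K need not be compact, but the density vanishes off the image of K
intersected with the support of the partition function. That image is compact and lies in the chart
target, where the density is continuous. -/
theorem integrableOn_formDensity {η : ∀ m : M, TopFormAt n M m}
    (hη : Continuous fun m => (⟨m, η m⟩ : TopFormBundle n M)) {K : Set M} (hK : IsCompact K) (i : M) :
    IntegrableOn (formDensity η i)
      ((chartAt (𝔼 n) i).target ∩ (chartAt (𝔼 n) i).symm ⁻¹' K) := by
  set C := (chartAt (𝔼 n) i) '' (K ∩ tsupport (chartPartition n M i)) with hC
  have hs := chartPartition_subordinate (n := n) i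
  have hCc : IsCompact C := (hK.inter_right (isClosed_tsupport _)).image_of_continuousOn
    ((chartAt (𝔼 n) i).continuousOn.mono fun x hx => hs hx.2)
  have hCt : C ⊆ (chartAt (𝔼 n) i).target := by
    rintro _ ⟨x, hx, rfl⟩; exact (chartAt (𝔼 n) i).map_source (hs hx.2)
  refine (((continuousOn_formDensity hη i).mono hCt).integrableOn_compact
    hCc).of_forall_sdiff_eq_zero (measurableSet_chart_preimage hK i) ?_
  rintro y ⟨⟨hy, hyK⟩, hyC⟩
  have : (chartAt (𝔼 n) i).symm y ∉ tsupport (chartPartition n M i) := fun h =>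
    hyC ⟨_, ⟨hyK, h⟩, (chartAt (𝔼 n) i).right_inv hy⟩
  rw [formDensity, image_eq_zero_of_notMem_tsupport this, zero_mul]

/-- By local finiteness only finitely many partition functions are nonzero somewhere on K. One index
set serves all forms at once, so the integrals of two forms can be subtracted term by term. -/
theorem integralForm_eq_sum {K : Set M} (hK : IsCompact K) : ∃ s : Finset M,
    (∀ i, (∃ x ∈ K, chartPartition n M i x ≠ 0) → i ∈ s) ∧ ∀ η : ∀ m : M, TopFormAt n M m, integralForm K η =
      ∑ i ∈ s, ∫ y in (chartAt (𝔼 n) i).target ∩ (chartAt (𝔼 n) i).symm ⁻¹' K, formDensity η i y := by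
  have hf := (chartPartition n M).locallyFinite.finite_nonempty_inter_compact hK
  refine ⟨hf.toFinset, fun i ⟨x, hx, hx0⟩ => hf.mem_toFinset.2 ⟨x, hx0, hx⟩, fun η => ?_⟩
  refine finsum_eq_sum_of_support_subset _ fun i hi => ?_
  rw [Finite.coe_toFinset]
  by_contra hne
  refine hi (setIntegral_eq_zero_of_forall_eq_zero fun y hy => ?_)
  have : chartPartition n M i ((chartAt (𝔼 n) i).symm y) = 0 := by
    by_contra h0
    exact hne ⟨_, h0, hy.2⟩
  rw [this, zero_mul]

/-- If the inequality failed at m, its strict reverse would hold on a compact neighbourhood K. The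
difference of the integrals over K is then a sum of nonnegative terms, one of which is positive. -/
theorem form_coordVec_le_of_integralForm_eq {η η' : ∀ m : M, TopFormAt n M m}
    (hη : Continuous fun m => (⟨m, η m⟩ : TopFormBundle n M))
    (hη' : Continuous fun m => (⟨m, η' m⟩ : TopFormBundle n M))
    (h : ∀ K : Set M, IsCompact K → integralForm K η = integralForm K η') (m : M) :
    (η m (coordVec m m) : ℝ) ≤ (η' m (coordVec m m) : ℝ) := by
  by_contra hlt
  rw [not_le] at hlt
  have := ChartedSpace.locallyCompactSpace (𝔼 n) M
  set c := chartAt (𝔼 n) m with hc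
  have hms : m ∈ c.source := mem_chart_source _ m
  have hev : ∀ᶠ x in 𝓝 m, x ∈ c.source ∧ (η' x (coordVec m x) : ℝ) < (η x (coordVec m x) : ℝ) :=
    (c.open_source.eventually_mem hms).and
      (((continuousOn_form_coordVec hη' m).continuousAt (c.open_source.mem_nhds hms)).eventually_lt
        ((continuousOn_form_coordVec hη m).continuousAt (c.open_source.mem_nhds hms)) hlt)
  obtain ⟨K, hKm, hKs, hK⟩ := LocallyCompactSpace.local_compact_nhds m _ hev
  obtain ⟨s, hsi, hs⟩ := integralForm_eq_sum (n := n) hK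
  -- The inequality is known in the chart at m and passes to every other chart because the Jacobian
  -- is positive.
  have hlt' : ∀ i x, x ∈ K → x ∈ (chartAt (𝔼 n) i).source →
      (η' x (coordVec i x) : ℝ) < (η x (coordVec i x) : ℝ) := by
    intro i x hx hxi
    rw [form_coordVec_eq_det_mul hxi (hKs hx).1, form_coordVec_eq_det_mul hxi (hKs hx).1]
    exact mul_lt_mul_of_pos_left (hKs hx).2 (OrientedAtlas.det_pos i m x hxi (hKs hx).1)
  set S : M → Set (𝔼 n) := fun i =>
    (chartAt (𝔼 n) i).target ∩ (chartAt (𝔼 n) i).symm ⁻¹' K with hS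
  have hle : ∀ i, ∀ y ∈ S i, 0 ≤ formDensity η i y - formDensity η' i y := by
    intro i y hy
    rw [sub_nonneg]
    exact mul_le_mul_of_nonneg_left (hlt' i _ hy.2 ((chartAt (𝔼 n) i).map_target hy.1)).le
      ((chartPartition n M).nonneg i _)
  have hint : ∀ i, IntegrableOn (fun y => formDensity η i y - formDensity η' i y) (S i) := fun i =>
    (integrableOn_formDensity hη hK i).sub (integrableOn_formDensity hη' hK i)
  have hsum : ∑ i ∈ s, ∫ y in S i, (formDensity η i y - formDensity η' i y) = 0 := by
    have : ∀ i, ∫ y in S i, (formDensity η i y - formDensity η' i y) =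
        (∫ y in S i, formDensity η i y) - ∫ y in S i, formDensity η' i y := fun i =>
      integral_sub (integrableOn_formDensity hη hK i) (integrableOn_formDensity hη' hK i)
    rw [Finset.sum_congr rfl fun i _ => this i, Finset.sum_sub_distrib, ← hs, ← hs, h K hK, sub_self]
  have hzero := (Finset.sum_eq_zero_iff_of_nonneg fun i _ =>
    setIntegral_nonneg (measurableSet_chart_preimage hK i) (hle i)).1 hsum
  -- An index whose partition function is positive at m. The difference of densities is positive
  -- near the image of m in that chart, so its support has positive measure.
  obtain ⟨i, hi⟩ := (chartPartition n M).exists_pos_of_mem (mem_univ m)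
  have hmi : m ∈ (chartAt (𝔼 n) i).source :=
    chartPartition_subordinate (n := n) i (subset_tsupport _ hi.ne')
  have hpos : 0 < ∫ y in S i, (formDensity η i y - formDensity η' i y) := by
    rw [setIntegral_pos_iff_support_of_nonneg_ae
      ((ae_restrict_iff' (measurableSet_chart_preimage hK i)).2 (Filter.Eventually.of_forall (hle i)))
      (hint i)]
    refine Measure.measure_pos_of_mem_nhds _ (x := chartAt (𝔼 n) i m) ?_
    have hcs : ContinuousAt (chartAt (𝔼 n) i).symm (chartAt (𝔼 n) i m) :=
      (chartAt (𝔼 n) i).continuousAt_symm ((chartAt (𝔼 n) i).map_source hmi)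
    rw [ContinuousAt, (chartAt (𝔼 n) i).left_inv hmi] at hcs
    filter_upwards [(chartAt (𝔼 n) i).open_target.mem_nhds ((chartAt (𝔼 n) i).map_source hmi),
      hcs hKm, hcs ((chartPartition n M i).contMDiff.continuous.continuousAt.eventually (lt_mem_nhds hi))]
      with y hy hyK hyp
    refine ⟨?_, hy, hyK⟩
    refine ne_of_gt (sub_pos.2 ?_)
    exact mul_lt_mul_of_pos_left (hlt' i _ hyK ((chartAt (𝔼 n) i).map_target hy)) hyp
  exact hpos.ne' (hzero i (hsi i ⟨m, mem_of_mem_nhds hKm, hi.ne'⟩))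

/-- Continuous top degree forms with equal integrals over all compact sets are equal. -/
theorem form_eq_of_integralForm_eq {η η' : ∀ m : M, TopFormAt n M m}
    (hη : Continuous fun m => (⟨m, η m⟩ : TopFormBundle n M))
    (hη' : Continuous fun m => (⟨m, η' m⟩ : TopFormBundle n M))
    (h : ∀ K : Set M, IsCompact K → integralForm K η = integralForm K η') (m : M) : η m = η' m :=
  form_eq_of_coordVec_eq (le_antisymm (form_coordVec_le_of_integralForm_eq hη hη' h m)
    (form_coordVec_le_of_integralForm_eq hη' hη (fun K hK => (h K hK).symm) m))

end Forms
end GaugeTheory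

/-! ### Continuity of families of jets -/

namespace GaugeTheory

section Jets

variable {n : ℕ} {M : Type*} [TopologicalSpace M] [ChartedSpace (𝔼 n) M] [IsManifold (𝓡 n) ∞ M]
variable {VE HE E VF HF F : Type*} [NormedAddCommGroup VE] [NormedSpace ℝ VE] [TopologicalSpace HE]
  {IE : ModelWithCorners ℝ VE HE} [TopologicalSpace E] [ChartedSpace HE E] [IsManifold IE ∞ E]
  [NormedAddCommGroup VF] [NormedSpace ℝ VF] [TopologicalSpace HF]
  {IF : ModelWithCorners ℝ VF HF} [TopologicalSpace F] [ChartedSpace HF F] [IsManifold IF ∞ F]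

/-- A jet at `m` as a point of the total space of the jet bundle. -/
def JetBundle.mk (π : C^∞⟮IE, E; 𝓡 n, M⟯) {m : M} (j : JetAt π m) : JetBundle π := ⟨m, j⟩

/-- A family of jets is continuous if the corresponding fibrewise linear map is. -/
theorem JetBundle.continuousOn_mk {π : C^∞⟮IE, E; 𝓡 n, M⟯} {w : ∀ x : M, JetAt π x} {U : Set M}
    (hU : IsOpen U)
    (hw : ContinuousOn (fun v : TangentBundle (𝓡 n) M =>
      (⟨(w v.1).pt, (w v.1).lin v.2⟩ : TangentBundle IE E)) (Bundle.TotalSpace.proj ⁻¹' U)) :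
    ContinuousOn (fun x => JetBundle.mk π (w x)) U := by
  have hind : Topology.IsInducing (JetBundle.toHom (π := π)) := ⟨rfl⟩
  rw [hind.continuousOn_iff]
  intro x₀ hx₀
  apply ContinuousAt.continuousWithinAt
  -- The Hom bundle is trivialized around the point of E, hence the pulled-back tangent bundle
  -- around its projection. That projection equals x₀ only propositionally, so it is kept as a
  -- variable until the end.
  obtain ⟨x₁, hx₁⟩ : ∃ x₁, x₁ = π (w x₀).pt := ⟨_, rfl⟩
  have hx₁₀ : x₁ = x₀ := hx₁.trans (w x₀).proj_pt
  have hmem : x₀ ∈ (chartAt (𝔼 n) x₁).source := hx₁₀ ▸ mem_chart_source _ x₁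
  set t := trivializationAt (𝔼 n) (TangentSpace (𝓡 n) : M → Type _) x₁ with ht
  -- The vector field with constant components e is continuous near x₀, and the fibrewise linear map
  -- can be applied to it. The case e = 0 then gives continuity of the base points.
  have hvec : ∀ e : 𝔼 n, ContinuousAt (fun x => (⟨(w x).pt, (w x).lin (t.symm x e)⟩ :
      TangentBundle IE E)) x₀ := by
    intro e
    have h1 : ContinuousOn (fun x => (⟨x, t.symm x e⟩ : TangentBundle (𝓡 n) M))
        (chartAt (𝔼 n) x₁).source :=
      t.continuousOn_symm.comp (continuousOn_id.prodMk continuousOn_const)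
        fun x hx => ⟨hx, mem_univ _⟩
    have h2 := (hw.continuousAt ((hU.preimage (FiberBundle.continuous_proj (𝔼 n)
      (TangentSpace (𝓡 n) : M → Type _))).mem_nhds (x := ⟨x₀, _⟩) hx₀)).comp
      (h1.continuousAt ((chartAt (𝔼 n) x₁).open_source.mem_nhds hmem))
    exact h2
  have hpt : ContinuousAt (fun x => (w x).pt) x₀ :=
    (FiberBundle.continuous_proj VE (TangentSpace IE : E → Type _)).continuousAt.comp (hvec 0)
  refine (FiberBundle.continuousAt_totalSpace _ _).2 ⟨hpt, ?_⟩
  -- The model space of M has finite dimension, so continuity in operator norm may be tested vector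
  -- by vector.
  rw [continuousAt_clm_apply]
  intro e
  have h3 := ((FiberBundle.continuousAt_totalSpace _ _).1 (hvec e)).2
  refine h3.congr ?_
  filter_upwards [(chartAt (𝔼 n) x₁).open_source.mem_nhds hmem,
    hpt.preimage_mem_nhds (chart_source_mem_nhds HE _)] with x hx hxE
  have e1 : ∀ u, ((trivializationAt VE (TangentSpace IE : E → Type _) (w x₀).pt)
      ⟨(w x).pt, u⟩).2 = (trivializationAt VE (TangentSpace IE : E → Type _)
        (w x₀).pt).continuousLinearMapAt ℝ (w x).pt u := fun u =>
    (Bundle.Trivialization.continuousLinearMapAt_apply_of_mem ℝ _ hxE u).symm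
  refine (e1 _).trans ?_
  have e2 : @Eq (𝔼 n) (t.symm x e) ((t.pullback π).symmL ℝ (w x).pt e) := by
    have hx' : (w x).pt ∈ (t.pullback π).baseSet := by
      change π (w x).pt ∈ (chartAt (𝔼 n) x₁).source
      rwa [(w x).proj_pt]
    have e3 : @Eq (𝔼 n) ((t.pullback π).symmL ℝ (w x).pt e) (t.symm (π (w x).pt) e) := by
      refine ((t.pullback π).symmL_apply (R := ℝ) hx' e).trans ?_
      exact (t.pullback π).symm_apply hx' e
    refine Eq.trans ?_ e3.symm
    have e4 : ∀ z, z = x → @Eq (𝔼 n) (t.symm x e) (t.symm z e) := by rintro z rfl; rfl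
    exact e4 _ (w x).proj_pt
  subst hx₁
  exact congrArg (fun u : 𝔼 n => (trivializationAt VE (TangentSpace IE : E → Type _)
        (w x₀).pt).continuousLinearMapAt ℝ (w x).pt ((w x).lin u)) e2

/-- The jet prolongation of a smooth global section is continuous. -/
theorem GlobalSection.continuous_jet {π : C^∞⟮IE, E; 𝓡 n, M⟯} (φ : GlobalSection π) :
    Continuous fun x => JetBundle.mk π (φ.jet x) := by
  rw [← continuousOn_univ]
  refine JetBundle.continuousOn_mk isOpen_univ ?_
  have h : ContMDiff (𝓡 n) IE ∞ φ.toFun := contMDiffOn_univ.1 φ.isSectionOn.contMDiffOn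
  exact (h.continuous_tangentMap (by simp)).continuousOn

end Jets
end GaugeTheory

/-! ### From invariant functionals to pointwise invariance along global fields -/

namespace GaugeTheory
namespace PrincipalBundle

variable {n d k : ℕ} {G M : Type*}
  [TopologicalSpace G] [ChartedSpace (𝔼 d) G] [Group G] [LieGroup (𝓡 d) ∞ G]
  [TopologicalSpace M] [ChartedSpace (𝔼 n) M] [IsManifold (𝓡 n) ∞ M]
  {B : PrincipalBundle n d G M}

/-- A point of a fibre of the connection bundle as a point of its total space. -/
def ConnectionBundle.mk (B : PrincipalBundle n d G M) {m : M} (A : B.ConnectionAt m) :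
    B.ConnectionBundle := ⟨m, A⟩

/-- A principal connection is a continuous section of the connection bundle. -/
theorem Connection.continuous (A : B.Connection) :
    Continuous fun x => ConnectionBundle.mk B (A.toFun x) := by
  rw [continuous_iff_continuousAt]
  intro m
  obtain ⟨U, hU, hm, w, h1, h2⟩ := A.smooth m
  have h3 := (JetBundle.continuousOn_mk hU h2.continuousOn).continuousAt (hU.mem_nhds hm)
  have h4 : Continuous B.toConnectionBundle := continuous_coinduced_rng
  refine (h4.continuousAt.comp h3).congr ?_
  filter_upwards [hU.mem_nhds hm] with x hx
  exact congrArg (ConnectionBundle.mk B) (h1 x hx).symm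

variable {Q : Type*} [MulAction G Q] [TopologicalSpace Q] [ChartedSpace (𝔼 k) Q]
  [IsManifold (𝓡 k) ∞ Q] [ContMDiffSMul (𝓡 d) (𝓡 k) ∞ G Q]

/-- A point of a fibre of `CP ×_M J(P ×_G Q)` as a point of the total space. -/
def CoupledBundle.mk (B : PrincipalBundle n d G M) (k : ℕ) (Q : Type*) [MulAction G Q]
    [TopologicalSpace Q] [ChartedSpace (𝔼 k) Q] [IsManifold (𝓡 k) ∞ Q]
    [ContMDiffSMul (𝓡 d) (𝓡 k) ∞ G Q] {m : M} (A : B.ConnectionAt m)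
    (b : JetAt (B.matterProj k Q) m) : B.CoupledBundle k Q := ⟨m, A, b⟩

theorem continuous_coupled_mk (A : B.Connection) (φ : GlobalSection (B.matterProj k Q)) :
    Continuous fun x => CoupledBundle.mk B k Q (A.toFun x) (φ.jet x) :=
  continuous_induced_rng.2 (A.continuous.prodMk φ.continuous_jet)

variable [T2Space M] [SigmaCompactSpace M] [OrientedAtlas n M]

/-- Both integrands are continuous forms, since the Lagrangian and the jet prolongations are
continuous, and their integrals agree over every compact set. -/
theorem MatterLagrangian.IsGaugeInvariant.apply_eq {L : B.MatterLagrangian k Q}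
    (hL : L.IsGaugeInvariant) (f : B.GaugeTransformation) (φ : GlobalSection (B.matterProj k Q))
    (m : M) : L.toFun m ((f.mapSection φ).jet m) = L.toFun m (φ.jet m) :=
  form_eq_of_integralForm_eq (η := fun m => L.toFun m ((f.mapSection φ).jet m))
    (η' := fun m => L.toFun m (φ.jet m)) (L.continuous.comp (f.mapSection φ).continuous_jet)
    (L.continuous.comp φ.continuous_jet) (fun K hK => hL K hK f φ) m

theorem CoupledLagrangian.IsGaugeInvariant.apply_eq {L : B.CoupledLagrangian k Q}
    (hL : L.IsGaugeInvariant) (f : B.GaugeTransformation) (A : B.Connection)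
    (φ : GlobalSection (B.matterProj k Q)) (m : M) :
    L.toFun m (f.connectionMap (A.toFun m)) ((f.mapSection φ).jet m) =
      L.toFun m (A.toFun m) (φ.jet m) :=
  form_eq_of_integralForm_eq
    (η := fun m => L.toFun m (f.connectionMap (A.toFun m)) ((f.mapSection φ).jet m))
    (η' := fun m => L.toFun m (A.toFun m) (φ.jet m))
    (L.continuous.comp (continuous_coupled_mk (f.mapConnection A) (f.mapSection φ)))
    (L.continuous.comp (continuous_coupled_mk A φ)) (fun K hK => hL K hK f A φ) m

end PrincipalBundle
end GaugeTheory

/-! ### Extending germs of local sections to global sections -/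

namespace GaugeTheory
namespace PrincipalBundle

variable {n d k : ℕ} {G M : Type*}
  [TopologicalSpace G] [ChartedSpace (𝔼 d) G] [Group G] [LieGroup (𝓡 d) ∞ G]
  [TopologicalSpace M] [ChartedSpace (𝔼 n) M] [IsManifold (𝓡 n) ∞ M]
  {B : PrincipalBundle n d G M}
  {Q : Type*} [MulAction G Q] [TopologicalSpace Q] [ChartedSpace (𝔼 k) Q]
  [IsManifold (𝓡 k) ∞ Q] [ContMDiffSMul (𝓡 d) (𝓡 k) ∞ G Q]

namespace Assoc

theorem trivSnd_mk_sec (T : B.LocalTriv) {x : M} (hx : x ∈ T.base) (q : Q) :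
    trivSnd T (mk (T.sec x) q : B.Assoc Q) = q := by
  rw [trivSnd_mk T (T.sec_mem hx), T.hom_sec hx, one_smul]

theorem contMDiffOn_trivSnd (T : B.LocalTriv) :
    ContMDiffOn ((𝓡 n).prod (𝓡 k)) (𝓡 k) ∞ (trivSnd T : B.Assoc Q → Q) (projFun ⁻¹' T.base) :=
  contMDiff_snd.comp_contMDiffOn (contMDiffOn_triv (k := k) T)

/-- A local section of an associated bundle given by its fibre coordinate. -/
theorem isSectionOn_mk_sec (T : B.LocalTriv) {h : M → Q} {U : Set M} (hU : U ⊆ T.base)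
    (hh : ContMDiffOn (𝓡 n) (𝓡 k) ∞ h U) :
    IsSectionOn (B.matterProj k Q) (fun x => mk (T.sec x) (h x)) U where
  contMDiffOn := (contMDiffOn_triv_symm (k := k) T).comp (contMDiffOn_id.prodMk hh)
    fun _ hx => ⟨hU hx, mem_univ _⟩
  proj_eq _ hx := T.proj_sec (hU hx)

theorem contMDiffOn_trivSnd_section (T : B.LocalTriv) {φ : M → B.Assoc Q} {U : Set M}
    (hφ : IsSectionOn (B.matterProj k Q) φ U) :
    ContMDiffOn (𝓡 n) (𝓡 k) ∞ (fun x => trivSnd T (φ x)) (U ∩ T.base) :=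
  (contMDiffOn_trivSnd (k := k) T).comp (hφ.contMDiffOn.mono inter_subset_left) fun x hx => by
    change projFun (φ x) ∈ T.base
    rw [show projFun (φ x) = x from hφ.proj_eq x hx.1]
    exact hx.2

theorem mk_sec_trivSnd_section (T : B.LocalTriv) {φ : M → B.Assoc Q} {U : Set M}
    (hφ : IsSectionOn (B.matterProj k Q) φ U) {x : M} (hx : x ∈ U) (hxT : x ∈ T.base) :
    mk (T.sec x) (trivSnd T (φ x)) = φ x := by
  have h : projFun (φ x) = x := hφ.proj_eq x hx
  have h2 := mk_sec_trivSnd T (e := φ x) (h.symm ▸ hxT)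
  rwa [h] at h2

end Assoc

open Assoc

/-- The preimage in a manifold of a ball in a chart. -/
def chartBall (q : Q) (r : ℝ) : Set Q :=
  (chartAt (𝔼 k) q).source ∩ chartAt (𝔼 k) q ⁻¹' Metric.ball (chartAt (𝔼 k) q q) r

theorem isOpen_chartBall (q : Q) (r : ℝ) : IsOpen (chartBall (k := k) q r) :=
  (chartAt (𝔼 k) q).isOpen_inter_preimage Metric.isOpen_ball

theorem mem_chartBall (q : Q) {r : ℝ} (hr : 0 < r) : q ∈ chartBall (k := k) q r :=
  ⟨mem_chart_source _ q, Metric.mem_ball_self hr⟩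

variable [T2Space M]

/-- If a global section and a local section at `m` have values at `m` in a common ball of a chart of
the typical fibre, then the global section can be modified near `m` to agree with the local one. -/
theorem exists_globalSection_eventuallyEq_of_mem_chartBall {T : B.LocalTriv} {q : Q} {r : ℝ}
    (hr : Metric.ball (chartAt (𝔼 k) q q) r ⊆ (chartAt (𝔼 k) q).target)
    (φ : GlobalSection (B.matterProj k Q)) {ψ : M → B.Assoc Q} {U : Set M} (hU : IsOpen U)
    (hψ : IsSectionOn (B.matterProj k Q) ψ U) {m : M} (hm : m ∈ U) (hmT : m ∈ T.base)
    (h1 : trivSnd T (φ.toFun m) ∈ chartBall (k := k) q r)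
    (h2 : trivSnd T (ψ m) ∈ chartBall (k := k) q r) :
    ∃ φ' : GlobalSection (B.matterProj k Q), φ'.toFun =ᶠ[𝓝 m] ψ := by
  classical
  set c := chartAt (𝔼 k) q with hc
  have hφs := contMDiffOn_trivSnd_section T φ.isSectionOn
  have hψs := contMDiffOn_trivSnd_section T hψ
  rw [univ_inter] at hφs
  set N : Set M := (T.base ∩ (fun x => trivSnd T (φ.toFun x)) ⁻¹' chartBall (k := k) q r) ∩
    ((U ∩ T.base) ∩ (fun x => trivSnd T (ψ x)) ⁻¹' chartBall (k := k) q r) with hN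
  have hNo : IsOpen N :=
    (hφs.continuousOn.isOpen_inter_preimage T.isOpen_base (isOpen_chartBall q r)).inter
      (hψs.continuousOn.isOpen_inter_preimage (hU.inter T.isOpen_base) (isOpen_chartBall q r))
  have hmN : m ∈ N := ⟨⟨hmT, h1⟩, ⟨hm, hmT⟩, h2⟩
  -- On N both fibre coordinates lie in the chart ball, where they can be interpolated linearly with
  -- weight χ. The ball is convex and contained in the chart target, so the interpolation stays in
  -- the chart.
  obtain ⟨χ, -, hχ⟩ := (SmoothBumpFunction.nhds_basis_tsupport (I := 𝓡 n) m).mem_iff.1 (hNo.mem_nhds hmN)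
  set v : M → 𝔼 k := fun x =>
    (1 - χ x) • c (trivSnd T (φ.toFun x)) + χ x • c (trivSnd T (ψ x)) with hv
  have hvN : ∀ x ∈ N, v x ∈ Metric.ball (c q) r := fun x hx =>
    convex_ball (c q) r hx.1.2.2 hx.2.2.2 (sub_nonneg.2 χ.le_one) χ.nonneg (by ring)
  have hcφ : ContMDiffOn (𝓡 n) 𝓘(ℝ, 𝔼 k) ∞ (fun x => c (trivSnd T (φ.toFun x))) N :=
    (contMDiffOn_chart (I := 𝓡 k)).comp (hφs.mono fun x hx => hx.1.1) fun x hx => hx.1.2.1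
  have hcψ : ContMDiffOn (𝓡 n) 𝓘(ℝ, 𝔼 k) ∞ (fun x => c (trivSnd T (ψ x))) N :=
    (contMDiffOn_chart (I := 𝓡 k)).comp (hψs.mono fun x hx => hx.2.1) fun x hx => hx.2.2.1
  have hvs : ContMDiffOn (𝓡 n) 𝓘(ℝ, 𝔼 k) ∞ v N :=
    ((contMDiffOn_const.sub χ.contMDiff.contMDiffOn).smul hcφ).add
      (χ.contMDiff.contMDiffOn.smul hcψ)
  have hsec : IsSectionOn (B.matterProj k Q) (fun x => Assoc.mk (T.sec x) (c.symm (v x))) N :=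
    isSectionOn_mk_sec T (fun x hx => hx.1.1)
      ((contMDiffOn_chart_symm (I := 𝓡 k)).comp hvs fun x hx => hr (hvN x hx))
  set φ' : M → B.Assoc Q := fun x => if x ∈ N then Assoc.mk (T.sec x) (c.symm (v x)) else φ.toFun x
    with hφ'
  -- Where χ vanishes, the interpolated formula gives back φ. The two branches of φ' therefore agree
  -- off the support of χ, and no discontinuity arises at the boundary of N.
  have hout : ∀ x ∉ tsupport χ, φ' =ᶠ[𝓝 x] φ.toFun := by
    intro x hx
    filter_upwards [(isClosed_tsupport χ).isOpen_compl.mem_nhds hx] with y hy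
    by_cases hyN : y ∈ N
    · have h0 : χ y = 0 := image_eq_zero_of_notMem_tsupport hy
      simp only [hφ', if_pos hyN, hv, h0, sub_zero, one_smul, zero_smul, add_zero]
      rw [c.left_inv hyN.1.2.1]
      exact mk_sec_trivSnd_section T φ.isSectionOn (mem_univ y) hyN.1.1
    · simp only [hφ', if_neg hyN]
  have hin : ∀ x ∈ N, φ' =ᶠ[𝓝 x] fun x => Assoc.mk (T.sec x) (c.symm (v x)) := by
    intro x hx
    filter_upwards [hNo.mem_nhds hx] with y hy
    simp only [hφ', if_pos hy]
  have hall : ∀ x, ContMDiffAt (𝓡 n) ((𝓡 n).prod (𝓡 k)) ∞ φ' x ∧ B.matterProj k Q (φ' x) = x := by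
    intro x
    by_cases hx : x ∈ tsupport χ
    · refine ⟨(hsec.contMDiffOn.contMDiffAt (hNo.mem_nhds (hχ hx))).congr_of_eventuallyEq
        (hin x (hχ hx)), ?_⟩
      rw [(hin x (hχ hx)).eq_of_nhds]
      exact hsec.proj_eq x (hχ hx)
    · refine ⟨(φ.isSectionOn.contMDiffOn.contMDiffAt Filter.univ_mem).congr_of_eventuallyEq
        (hout x hx), ?_⟩
      rw [(hout x hx).eq_of_nhds]
      exact φ.isSectionOn.proj_eq x (mem_univ x)
  refine ⟨⟨φ', fun x _ => (hall x).1.contMDiffWithinAt, fun x _ => (hall x).2⟩, ?_⟩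
  refine (hin m hmN).trans ?_
  filter_upwards [hNo.mem_nhds hmN, χ.eventuallyEq_one] with x hx hx1
  have h0 : χ x = 1 := hx1
  simp only [hv, h0, sub_self, zero_smul, one_smul, zero_add]
  rw [c.left_inv hx.2.2.1]
  exact mk_sec_trivSnd_section T hψ hx.2.1.1 hx.1.1

/-- If every connected component of every fibre of an associated bundle is met by a global section,
then every germ of a local section extends to a global section. -/
theorem exists_globalSection_eventuallyEq
    (hQ : ∀ (p : B.Carrier) (q : Q), ∃ φ : GlobalSection (B.matterProj k Q),
      ∃ q' ∈ connectedComponent q, φ.toFun (B.proj p) = Assoc.mk p q')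
    {ψ : M → B.Assoc Q} {U : Set M} (hU : IsOpen U)
    (hψ : IsSectionOn (B.matterProj k Q) ψ U) {m : M} (hm : m ∈ U) :
    ∃ φ : GlobalSection (B.matterProj k Q), φ.toFun =ᶠ[𝓝 m] ψ := by
  set T := B.localTriv m
  have hmT : m ∈ T.base := B.mem_localTriv m
  have hball : ∀ q : Q, ∃ r > 0, Metric.ball (chartAt (𝔼 k) q q) r ⊆ (chartAt (𝔼 k) q).target :=
    fun q => Metric.isOpen_iff.1 (chartAt (𝔼 k) q).open_target _ (mem_chart_target _ q)
  choose r hr0 hr using hball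
  set R : Set Q := {q | ∃ φ : GlobalSection (B.matterProj k Q), trivSnd T (φ.toFun m) = q} with hR
  -- If one point of a chart ball is attained by a global section, so is every other one: modify
  -- that section towards the local section with constant coordinate q₂. Every such ball is thus
  -- contained in R or disjoint from it, and R is clopen.
  have hstep : ∀ q q₁ q₂, q₁ ∈ chartBall (k := k) q (r q) → q₂ ∈ chartBall (k := k) q (r q) →
      q₁ ∈ R → q₂ ∈ R := by
    rintro q q₁ q₂ h₁ h₂ ⟨φ, hφ⟩
    have hs := isSectionOn_mk_sec (k := k) (B := B) T (h := fun _ => q₂) subset_rfl contMDiffOn_const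
    obtain ⟨φ', hφ'⟩ := exists_globalSection_eventuallyEq_of_mem_chartBall (hr q) φ T.isOpen_base
      hs hmT hmT (hφ.symm ▸ h₁) ((trivSnd_mk_sec T hmT q₂).symm ▸ h₂)
    exact ⟨φ', by rw [hφ'.eq_of_nhds, trivSnd_mk_sec T hmT]⟩
  have hclopen : IsClopen R := by
    refine ⟨⟨isOpen_iff_mem_nhds.2 fun q hq => ?_⟩, isOpen_iff_mem_nhds.2 fun q hq => ?_⟩
    · filter_upwards [(isOpen_chartBall (k := k) q (r q)).mem_nhds (mem_chartBall (k := k) q (hr0 q))] with q' hq' hR'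
      exact hq (hstep q q' q hq' (mem_chartBall (k := k) q (hr0 q)) hR')
    · filter_upwards [(isOpen_chartBall (k := k) q (r q)).mem_nhds (mem_chartBall (k := k) q (hr0 q))] with q' hq'
      exact hstep q q q' (mem_chartBall (k := k) q (hr0 q)) hq' hq
  have hq : trivSnd T (ψ m) ∈ R := by
    obtain ⟨φ, q', hq', hφ⟩ := hQ (T.sec m) (trivSnd T (ψ m))
    rw [T.proj_sec hmT] at hφ
    have h : q' ∈ R := ⟨φ, by rw [hφ, trivSnd_mk_sec T hmT]⟩
    exact hclopen.connectedComponent_subset h ((connectedComponent_eq hq') ▸ mem_connectedComponent)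
  obtain ⟨φ, hφ⟩ := hq
  have hb := mem_chartBall (k := k) (trivSnd T (ψ m)) (hr0 (trivSnd T (ψ m)))
  -- Now φ and ψ have the same value at m, so they share the chart ball centred at it, and a last
  -- modification makes the germs agree.
  exact exists_globalSection_eventuallyEq_of_mem_chartBall (hr (trivSnd T (ψ m))) φ hU hψ hm hmT
    (hφ.symm ▸ hb) hb

end PrincipalBundle
end GaugeTheory

/-! ### Gauge transformations as sections of the gauge group bundle -/

namespace GaugeTheory

theorem ConjFibre.contMDiff_of {d : ℕ} {G : Type*} [TopologicalSpace G] [ChartedSpace (𝔼 d) G] :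
    ContMDiff (𝓡 d) (𝓡 d) ∞ (ConjFibre.of : G → ConjFibre G) := contMDiff_id (M := G)

theorem ConjFibre.contMDiff_val {d : ℕ} {G : Type*} [TopologicalSpace G] [ChartedSpace (𝔼 d) G] :
    ContMDiff (𝓡 d) (𝓡 d) ∞ (ConjFibre.val : ConjFibre G → G) := contMDiff_id (M := G)

namespace PrincipalBundle

variable {n d k : ℕ} {G M : Type*}
  [TopologicalSpace G] [ChartedSpace (𝔼 d) G] [Group G] [LieGroup (𝓡 d) ∞ G]
  [TopologicalSpace M] [ChartedSpace (𝔼 n) M] [IsManifold (𝓡 n) ∞ M]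
  {B : PrincipalBundle n d G M}

theorem gaugeAct_mk_self (p : B.Carrier) (g : G) :
    B.gaugeAct (Assoc.mk p (ConjFibre.of g)) p = B.act p g := by
  simpa [act_one] using B.gaugeAct_mk p g 1

namespace GaugeTransformation

variable (f : B.GaugeTransformation)

theorem exists_coeff (p : B.Carrier) : ∃ g, B.act p g = f.toDiffeomorph p :=
  B.exists_act_eq (f.proj_map p).symm

/-- The function `g : P → G` such that `f(p) = p · g(p)`. -/
noncomputable def coeff (p : B.Carrier) : G := (f.exists_coeff p).choose

theorem act_coeff (p : B.Carrier) : B.act p (f.coeff p) = f.toDiffeomorph p :=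
  (f.exists_coeff p).choose_spec

theorem coeff_act (p : B.Carrier) (h : G) : f.coeff (B.act p h) = h⁻¹ * f.coeff p * h := by
  apply B.act_injective (B.act p h)
  rw [act_coeff, f.map_act, ← f.act_coeff p, ← B.act_mul, ← B.act_mul]
  congr 1; group

theorem contMDiffOn_coeff_sec (T : B.LocalTriv) :
    ContMDiffOn (𝓡 n) (𝓡 d) ∞ (fun x => f.coeff (T.sec x)) T.base := by
  have h1 : ContMDiffOn (𝓡 n) (𝓡 d) ∞ (fun x => (T.hom (f.toDiffeomorph (T.sec x))).2) T.base :=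
    contMDiff_snd.comp_contMDiffOn (T.contMDiffOn_hom.comp
      (f.toDiffeomorph.contMDiff.comp_contMDiffOn T.contMDiffOn_sec) fun x hx =>
        T.mem_source.2 (by
          change B.proj (f.toDiffeomorph (T.sec x)) ∈ T.base
          rwa [f.proj_map, T.proj_sec hx]))
  refine h1.congr fun x hx => ?_
  rw [← f.act_coeff, T.snd_hom _ (T.sec_mem hx), T.hom_sec hx, one_mul]

/-- The coefficient changes by conjugation along the fibre, which is exactly the identification made
in the gauge group bundle. The associated section may thus be computed from any point of the fibre,
in particular along a fixed smooth local section. -/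
theorem mk_coeff_eq {p p' : B.Carrier} (h : B.proj p = B.proj p') :
    (Assoc.mk p (ConjFibre.of (f.coeff p)) : B.GaugeBundle) =
      Assoc.mk p' (ConjFibre.of (f.coeff p')) := by
  obtain ⟨g, rfl⟩ := B.exists_act_eq h
  rw [Assoc.mk_act, ConjFibre.smul_of, coeff_act]
  congr 2; group

/-- The section of the gauge group bundle corresponding to a gauge transformation. -/
noncomputable def toSection : GlobalSection B.gaugeProj where
  toFun x := Assoc.mk ((B.localTriv x).sec x) (ConjFibre.of (f.coeff ((B.localTriv x).sec x)))
  isSectionOn :=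
    { contMDiffOn := by
        intro x _
        set T := B.localTriv x with hT
        have h := Assoc.isSectionOn_mk_sec (k := d) T subset_rfl
          (ConjFibre.contMDiff_of.comp_contMDiffOn (f.contMDiffOn_coeff_sec T))
        refine ((h.contMDiffOn.contMDiffAt (T.isOpen_base.mem_nhds
          (B.mem_localTriv x))).congr_of_eventuallyEq ?_).contMDiffWithinAt
        filter_upwards [T.isOpen_base.mem_nhds (B.mem_localTriv x)] with y hy
        apply f.mk_coeff_eq
        rw [T.proj_sec hy, (B.localTriv y).proj_sec (B.mem_localTriv y)]
      proj_eq := fun x _ => (B.localTriv x).proj_sec (B.mem_localTriv x) }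

theorem toSection_proj (p : B.Carrier) :
    f.toSection.toFun (B.proj p) = Assoc.mk p (ConjFibre.of (f.coeff p)) :=
  f.mk_coeff_eq ((B.localTriv _).proj_sec (B.mem_localTriv _))

theorem gaugeAct_toSection (p : B.Carrier) :
    B.gaugeAct (f.toSection.toFun (B.proj p)) p = f.toDiffeomorph p := by
  rw [toSection_proj, gaugeAct_mk_self, act_coeff]

theorem gaugeActAssoc_toSection {Q : Type*} [MulAction G Q] (e : B.Assoc Q) :
    B.gaugeActAssoc (f.toSection.toFun (Assoc.projFun e)) e = f.assocFun e := by
  induction e using Assoc.ind with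
  | h p q =>
    rw [Assoc.projFun_mk, toSection_proj, gaugeActAssoc_mk, assocFun_mk, ← act_coeff, Assoc.mk_act]

end GaugeTransformation

namespace GaugeSection

variable (γ : GlobalSection B.gaugeProj)

theorem exists_coeff (p : B.Carrier) : ∃ g : ConjFibre G, γ.toFun (B.proj p) = Assoc.mk p g :=
  Assoc.exists_eq_mk (γ.isSectionOn.proj_eq _ (mem_univ _))

/-- The function `g : P → G` such that `γ(ρ(p)) = [p, g(p)]`. -/
noncomputable def coeff (p : B.Carrier) : G := ConjFibre.val (exists_coeff γ p).choose

theorem mk_coeff (p : B.Carrier) :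
    γ.toFun (B.proj p) = Assoc.mk p (ConjFibre.of (coeff γ p)) :=
  (exists_coeff γ p).choose_spec

theorem coeff_act (p : B.Carrier) (h : G) : coeff γ (B.act p h) = h⁻¹ * coeff γ p * h := by
  have h1 := mk_coeff γ (B.act p h)
  rw [B.proj_act', mk_coeff, Assoc.mk_act, ConjFibre.smul_of] at h1
  have h2 : coeff γ p = h * coeff γ (B.act p h) * h⁻¹ :=
    Assoc.mk_injective (B := B) (Q := ConjFibre G) p h1
  rw [h2]; group

/-- With p = s · t, for the local section s of a trivialization and the group coordinate t of p, the
coefficient is t⁻¹ c t. Here c, the coefficient at s, is the fibre coordinate of γ; all three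
factors are smooth. -/
theorem contMDiff_coeff : ContMDiff (𝓡 (n + d)) (𝓡 d) ∞ (coeff γ) := by
  intro p
  set T := B.localTriv (B.proj p)
  have hp : p ∈ T.hom.source := T.mem_source.2 (B.mem_localTriv _)
  have h1 : ContMDiffOn (𝓡 (n + d)) (𝓡 d) ∞ (fun p => (T.hom p).2) T.hom.source :=
    contMDiff_snd.comp_contMDiffOn T.contMDiffOn_hom
  have h2 : ContMDiffOn (𝓡 (n + d)) (𝓡 d) ∞
      (fun p => ConjFibre.val (Assoc.trivSnd T (γ.toFun (B.proj p)))) T.hom.source :=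
    ConjFibre.contMDiff_val.comp_contMDiffOn
      ((Assoc.contMDiffOn_trivSnd_section T γ.isSectionOn).comp B.proj.contMDiff.contMDiffOn
        fun p hp => ⟨mem_univ _, T.mem_source.1 hp⟩)
  refine (((h1.inv.mul h2).mul h1).congr fun p hp => ?_).contMDiffAt (T.hom.open_source.mem_nhds hp)
  have hb := T.mem_source.1 hp
  have h3 : ConjFibre.val (Assoc.trivSnd T (γ.toFun (B.proj p))) = coeff γ (T.sec (B.proj p)) := by
    have h4 := mk_coeff γ (T.sec (B.proj p))
    rw [T.proj_sec hb] at h4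
    rw [h4, Assoc.trivSnd_mk_sec T hb]
    rfl
  conv_lhs => rw [← T.act_sec hp, coeff_act]
  simp only [Pi.mul_apply, h3]

/-- The gauge transformation corresponding to a section of the gauge group bundle. -/
noncomputable def toGaugeTransformation : B.GaugeTransformation where
  toDiffeomorph :=
    { toFun := fun p => B.act p (coeff γ p)
      -- Conjugating the coefficient by itself or its inverse does not change it, so it has the same
      -- value at p and at its images under both maps.
      invFun := fun p => B.act p (coeff γ p)⁻¹
      left_inv := fun p => by
        change B.act (B.act p (coeff γ p)) (coeff γ (B.act p (coeff γ p)))⁻¹ = p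
        rw [coeff_act, ← B.act_mul]
        convert B.act_one p using 2
        group
      right_inv := fun p => by
        change B.act (B.act p (coeff γ p)⁻¹) (coeff γ (B.act p (coeff γ p)⁻¹)) = p
        rw [coeff_act, ← B.act_mul]
        convert B.act_one p using 2
        group
      contMDiff_toFun := B.contMDiff_act'.comp (contMDiff_id.prodMk (contMDiff_coeff γ))
      contMDiff_invFun := B.contMDiff_act'.comp (contMDiff_id.prodMk (contMDiff_coeff γ).inv) }
  map_act p g := by
    change B.act (B.act p g) (coeff γ (B.act p g)) = B.act (B.act p (coeff γ p)) g
    rw [coeff_act, ← B.act_mul, ← B.act_mul]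
    congr 1; group
  proj_map p := B.proj_act' _ _

theorem toGaugeTransformation_apply (p : B.Carrier) :
    (toGaugeTransformation γ).toDiffeomorph p = B.gaugeAct (γ.toFun (B.proj p)) p := by
  rw [mk_coeff, gaugeAct_mk_self]; rfl

theorem assocFun_toGaugeTransformation {Q : Type*} [MulAction G Q] (e : B.Assoc Q) :
    (toGaugeTransformation γ).assocFun e = B.gaugeActAssoc (γ.toFun (Assoc.projFun e)) e := by
  induction e using Assoc.ind with
  | h p q =>
    rw [Assoc.projFun_mk, mk_coeff, gaugeActAssoc_mk, GaugeTransformation.assocFun_mk,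
      ← Assoc.mk_act]
    rfl

end GaugeSection

/-- If every connected component of every fibre of the gauge group bundle is met by a gauge
transformation, then it is met by a global section. -/
theorem exists_gaugeSection_mem_connectedComponent
    (hG : ∀ (p : B.Carrier) (g : G), ∃ f : B.GaugeTransformation, ∃ g' ∈ connectedComponent g,
      f.toDiffeomorph p = B.act p g') (p : B.Carrier) (q : ConjFibre G) :
    ∃ γ : GlobalSection (B.matterProj d (ConjFibre G)), ∃ q' ∈ connectedComponent q,
      γ.toFun (B.proj p) = Assoc.mk p q' := by
  obtain ⟨f, g', hg', hf⟩ := hG p (ConjFibre.val q)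
  refine ⟨f.toSection, ConjFibre.of g', hg', ?_⟩
  rw [f.toSection_proj, B.act_injective p ((f.act_coeff p).trans hf)]

end PrincipalBundle
end GaugeTheory

/-! ### Comparison of jets and well-definedness of the action on matter jets -/

namespace GaugeTheory

section Jets

variable {n : ℕ} {M : Type*} [TopologicalSpace M] [ChartedSpace (𝔼 n) M] [IsManifold (𝓡 n) ∞ M]
variable {VE HE E VF HF F VN HN N : Type*}
  [NormedAddCommGroup VE] [NormedSpace ℝ VE] [TopologicalSpace HE]
  {IE : ModelWithCorners ℝ VE HE} [TopologicalSpace E] [ChartedSpace HE E] [IsManifold IE ∞ E]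
  [NormedAddCommGroup VF] [NormedSpace ℝ VF] [TopologicalSpace HF]
  {IF : ModelWithCorners ℝ VF HF} [TopologicalSpace F] [ChartedSpace HF F] [IsManifold IF ∞ F]
  [NormedAddCommGroup VN] [NormedSpace ℝ VN] [TopologicalSpace HN]
  {IN : ModelWithCorners ℝ VN HN} [TopologicalSpace N] [ChartedSpace HN N] [IsManifold IN ∞ N]

/-- Every tangent space unfolds to the model space. Stating the equality of the linear parts there
avoids casts along the equality of base points. -/
theorem JetAt.ext_model {π : C^∞⟮IE, E; 𝓡 n, M⟯} {m : M} {j j' : JetAt π m} (h : j.pt = j'.pt)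
    (hl : @Eq (𝔼 n →L[ℝ] VE) j.lin j'.lin) : j = j' := by
  obtain ⟨e, he, u, hu⟩ := j
  obtain ⟨e', he', u', hu'⟩ := j'
  obtain rfl : e = e' := h
  obtain rfl : u = u' := hl
  rfl

theorem JetAt.lin_eq_of_eq {π : C^∞⟮IE, E; 𝓡 n, M⟯} {m : M} {j j' : JetAt π m} (h : j = j') :
    @Eq (𝔼 n →L[ℝ] VE) j.lin j'.lin := by rw [h]

theorem mfderiv_eq_of_eventuallyEq {f g : M → E} {m : M} (h : f =ᶠ[𝓝 m] g) :
    @Eq (𝔼 n →L[ℝ] VE) (mfderiv (𝓡 n) IE f m) (mfderiv (𝓡 n) IE g m) := h.mfderiv_eq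

/-- Local sections with the same germ have the same jet. -/
theorem IsSectionOn.jet_eq_of_eventuallyEq {π : C^∞⟮IE, E; 𝓡 n, M⟯} {φ ψ : M → E} {U V : Set M}
    (hφ : IsSectionOn π φ U) (hψ : IsSectionOn π ψ V) (hU : IsOpen U) (hV : IsOpen V) {m : M}
    (hmU : m ∈ U) (hmV : m ∈ V) (h : φ =ᶠ[𝓝 m] ψ) : hφ.jet hU hmU = hψ.jet hV hmV :=
  JetAt.ext_model h.eq_of_nhds (mfderiv_eq_of_eventuallyEq h)

theorem IsSectionOn.mdifferentiableAt {π : C^∞⟮IE, E; 𝓡 n, M⟯} {φ : M → E} {U : Set M}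
    (hφ : IsSectionOn π φ U) (hU : IsOpen U) {m : M} (hm : m ∈ U) :
    MDifferentiableAt (𝓡 n) IE φ m :=
  (hφ.contMDiffOn.contMDiffAt (hU.mem_nhds hm)).mdifferentiableAt (by simp)

/-- The jet of `f ∘ φ` is the image of the jet of `φ` under the prolongation of `f`. -/
theorem IsSectionOn.map_jet {π : C^∞⟮IE, E; 𝓡 n, M⟯} {φ : M → E} {U : Set M}
    (hφ : IsSectionOn π φ U) (hU : IsOpen U) {m : M} (hm : m ∈ U) (f : C^∞⟮IE, E; IE, E⟯)
    (hf : ∀ e, π (f e) = π e) (hfφ : IsSectionOn π (fun x => f (φ x)) U) :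
    (hφ.jet hU hm).map f hf = hfφ.jet hU hm := by
  refine JetAt.ext_model rfl ?_
  exact (mfderiv_comp m (f.contMDiff.mdifferentiableAt (by simp))
    (hφ.mdifferentiableAt hU hm)).symm

/-- The derivative of `x ↦ H (γ x, φ x)` depends only on the values and derivatives of `γ`
and `φ`. -/
theorem mfderiv_prod_eq_of_eq {H : F × E → N} {γ₁ γ₂ : M → F} {φ₁ φ₂ : M → E} {m : M}
    (hγ : γ₁ m = γ₂ m) (hφ : φ₁ m = φ₂ m)
    (dγ : @Eq (𝔼 n →L[ℝ] VF) (mfderiv (𝓡 n) IF γ₁ m) (mfderiv (𝓡 n) IF γ₂ m))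
    (dφ : @Eq (𝔼 n →L[ℝ] VE) (mfderiv (𝓡 n) IE φ₁ m) (mfderiv (𝓡 n) IE φ₂ m))
    (hγ₁ : MDifferentiableAt (𝓡 n) IF γ₁ m) (hγ₂ : MDifferentiableAt (𝓡 n) IF γ₂ m)
    (hφ₁ : MDifferentiableAt (𝓡 n) IE φ₁ m) (hφ₂ : MDifferentiableAt (𝓡 n) IE φ₂ m)
    (hH : MDifferentiableAt (IF.prod IE) IN H (γ₁ m, φ₁ m)) :
    @Eq (𝔼 n →L[ℝ] VN) (mfderiv (𝓡 n) IN (fun x => H (γ₁ x, φ₁ x)) m)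
      (mfderiv (𝓡 n) IN (fun x => H (γ₂ x, φ₂ x)) m) := by
  -- Fixing the derivative of H as a map of model spaces lets the same D be used at both,
  -- propositionally equal, points.
  obtain ⟨D, hD⟩ : ∃ D : VF × VE →L[ℝ] VN, HasMFDerivAt (IF.prod IE) IN H (γ₁ m, φ₁ m) D :=
    ⟨_, hH.hasMFDerivAt⟩
  have hD₂ : HasMFDerivAt (IF.prod IE) IN H (γ₂ m, φ₂ m) D := by rw [← hγ, ← hφ]; exact hD
  have h1 := (HasMFDerivAt.comp (g := H) (f := fun x => (γ₁ x, φ₁ x)) m hD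
    (hγ₁.hasMFDerivAt.prodMk hφ₁.hasMFDerivAt)).mfderiv
  have h2 := (HasMFDerivAt.comp (g := H) (f := fun x => (γ₂ x, φ₂ x)) m hD₂
    (hγ₂.hasMFDerivAt.prodMk hφ₂.hasMFDerivAt)).mfderiv
  have h3 : @Eq (𝔼 n →L[ℝ] VF × VE)
      (ContinuousLinearMap.prod (M₂ := VF) (M₃ := VE) (mfderiv (𝓡 n) IF γ₁ m) (mfderiv (𝓡 n) IE φ₁ m))
      (ContinuousLinearMap.prod (M₂ := VF) (M₃ := VE) (mfderiv (𝓡 n) IF γ₂ m)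
        (mfderiv (𝓡 n) IE φ₂ m)) := congrArg₂ (ContinuousLinearMap.prod (M₂ := VF) (M₃ := VE)) dγ dφ
  exact h1.trans ((congrArg (fun L => D.comp L) h3).trans h2.symm)

end Jets

namespace PrincipalBundle

variable {n d k : ℕ} {G M : Type*}
  [TopologicalSpace G] [ChartedSpace (𝔼 d) G] [Group G] [LieGroup (𝓡 d) ∞ G]
  [TopologicalSpace M] [ChartedSpace (𝔼 n) M] [IsManifold (𝓡 n) ∞ M]
  {B : PrincipalBundle n d G M}
  {Q : Type*} [MulAction G Q] [TopologicalSpace Q] [ChartedSpace (𝔼 k) Q]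
  [IsManifold (𝓡 k) ∞ Q] [ContMDiffSMul (𝓡 d) (𝓡 k) ∞ G Q]

/-- The action of the gauge group bundle on an associated bundle in a local trivialization. -/
noncomputable def gaugeActAssocTriv (T : B.LocalTriv) (z : B.GaugeBundle × B.Assoc Q) : B.Assoc Q :=
  Assoc.mk (T.sec (Assoc.projFun z.1)) (ConjFibre.val (Assoc.trivSnd T z.1) • Assoc.trivSnd T z.2)

/-- The action is defined by choice and has its geometric meaning only on pairs in the same fibre.
The local formula extends it smoothly to an open set of the full product, so that the chain rule
applies. -/
theorem contMDiffOn_gaugeActAssocTriv (T : B.LocalTriv) :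
    ContMDiffOn (((𝓡 n).prod (𝓡 d)).prod ((𝓡 n).prod (𝓡 k))) ((𝓡 n).prod (𝓡 k)) ∞
      (gaugeActAssocTriv (Q := Q) T)
      ((Assoc.projFun ⁻¹' T.base) ×ˢ (Assoc.projFun ⁻¹' T.base)) := by
  have h1 : ContMDiffOn (((𝓡 n).prod (𝓡 d)).prod ((𝓡 n).prod (𝓡 k))) (𝓡 d) ∞
      (fun z : B.GaugeBundle × B.Assoc Q => ConjFibre.val (Assoc.trivSnd T z.1))
      ((Assoc.projFun ⁻¹' T.base) ×ˢ (Assoc.projFun ⁻¹' T.base)) :=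
    ConjFibre.contMDiff_val.comp_contMDiffOn
      ((Assoc.contMDiffOn_trivSnd (k := d) T).comp contMDiffOn_fst fun z hz => hz.1)
  have h2 : ContMDiffOn (((𝓡 n).prod (𝓡 d)).prod ((𝓡 n).prod (𝓡 k))) (𝓡 k) ∞
      (fun z : B.GaugeBundle × B.Assoc Q => Assoc.trivSnd T z.2)
      ((Assoc.projFun ⁻¹' T.base) ×ˢ (Assoc.projFun ⁻¹' T.base)) :=
    (Assoc.contMDiffOn_trivSnd (k := k) T).comp contMDiffOn_snd fun z hz => hz.2
  have h3 : ContMDiffOn (((𝓡 n).prod (𝓡 d)).prod ((𝓡 n).prod (𝓡 k))) (𝓡 n) ∞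
      (fun z : B.GaugeBundle × B.Assoc Q => Assoc.projFun z.1)
      ((Assoc.projFun ⁻¹' T.base) ×ˢ (Assoc.projFun ⁻¹' T.base)) :=
    (B.gaugeProj.contMDiff.comp contMDiff_fst).contMDiffOn
  exact (Assoc.contMDiffOn_triv_symm (k := k) T).comp
    (h3.prodMk ((contMDiff_smul (I := 𝓡 d) (I' := 𝓡 k)).comp_contMDiffOn (h1.prodMk h2)))
    fun z hz => ⟨hz.1, mem_univ _⟩

theorem gaugeActAssocTriv_eq (T : B.LocalTriv) {x : M} (hx : x ∈ T.base) {γ : B.GaugeBundle}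
    {e : B.Assoc Q} (hγ : Assoc.projFun γ = x) (he : Assoc.projFun e = x) :
    gaugeActAssocTriv T (γ, e) = B.gaugeActAssoc γ e := by
  have h1 := Assoc.mk_sec_trivSnd T (e := γ) (hγ.symm ▸ hx)
  have h2 := Assoc.mk_sec_trivSnd T (e := e) (he.symm ▸ hx)
  rw [hγ] at h1
  rw [he] at h2
  conv_rhs => rw [← h1, ← h2]
  rw [gaugeActAssocTriv, hγ]
  exact (B.gaugeActAssoc_mk _ _ _).symm

theorem gaugeActAssoc_eventuallyEq {γ : M → B.GaugeBundle} {φ : M → B.Assoc Q} {U V : Set M}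
    (hγ : IsSectionOn B.gaugeProj γ U) (hφ : IsSectionOn (B.matterProj k Q) φ V)
    (hU : IsOpen U) (hV : IsOpen V) {m : M} (hmU : m ∈ U) (hmV : m ∈ V) (T : B.LocalTriv)
    (hmT : m ∈ T.base) : (fun x => B.gaugeActAssoc (γ x) (φ x)) =ᶠ[𝓝 m]
      fun x => gaugeActAssocTriv T (γ x, φ x) := by
  filter_upwards [hU.mem_nhds hmU, hV.mem_nhds hmV, T.isOpen_base.mem_nhds hmT] with x h1 h2 h3
  exact (gaugeActAssocTriv_eq T h3 (hγ.proj_eq x h1) (hφ.proj_eq x h2)).symm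

/-- The action of `J(P ×_G G)` on `J(P ×_G Q)` is well defined. -/
theorem jetActs_gaugeActAssoc_unique {m : M} {a : JetAt B.gaugeProj m}
    {b b' b'' : JetAt (B.matterProj k Q) m} (h' : JetActs B.gaugeActAssoc a b b')
    (h'' : JetActs B.gaugeActAssoc a b b'') : b' = b'' := by
  obtain ⟨U, hU, hmU, γ, φ, hγ, hφ, hγφ, rfl, rfl, rfl⟩ := h'
  obtain ⟨V, hV, hmV, γ', φ', hγ', hφ', hγφ', ha, hb, rfl⟩ := h''
  set T := B.localTriv m
  have hmT : m ∈ T.base := B.mem_localTriv m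
  have e1 := gaugeActAssoc_eventuallyEq hγ hφ hU hU hmU hmU T hmT
  have e2 := gaugeActAssoc_eventuallyEq hγ' hφ' hV hV hmV hmV T hmT
  have p1 : γ m = γ' m := (congrArg JetAt.pt ha).symm
  have p2 : φ m = φ' m := (congrArg JetAt.pt hb).symm
  have hH : MDifferentiableAt (((𝓡 n).prod (𝓡 d)).prod ((𝓡 n).prod (𝓡 k))) ((𝓡 n).prod (𝓡 k))
      (gaugeActAssocTriv (Q := Q) T) (γ m, φ m) := by
    refine ((contMDiffOn_gaugeActAssocTriv T).contMDiffAt (IsOpen.mem_nhds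
      ((T.isOpen_base.preimage Assoc.continuous_projFun).prod
        (T.isOpen_base.preimage Assoc.continuous_projFun)) ⟨?_, ?_⟩)).mdifferentiableAt (by simp)
    · change B.gaugeProj (γ m) ∈ T.base
      rwa [hγ.proj_eq m hmU]
    · change B.matterProj k Q (φ m) ∈ T.base
      rwa [hφ.proj_eq m hmU]
  refine JetAt.ext_model ?_ ?_
  · change B.gaugeActAssoc (γ m) (φ m) = B.gaugeActAssoc (γ' m) (φ' m)
    rw [p1, p2]
  -- Near m both products are given by the smooth local formula, and its derivative along two
  -- sections involves only their values and first derivatives.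
  · exact (mfderiv_eq_of_eventuallyEq e1).trans ((mfderiv_prod_eq_of_eq p1 p2
      (JetAt.lin_eq_of_eq ha).symm (JetAt.lin_eq_of_eq hb).symm
      (hγ.mdifferentiableAt hU hmU) (hγ'.mdifferentiableAt hV hmV)
      (hφ.mdifferentiableAt hU hmU) (hφ'.mdifferentiableAt hV hmV) hH).trans
      (mfderiv_eq_of_eventuallyEq e2).symm)

end PrincipalBundle
end GaugeTheory

/-! ### Realizing points of JP by local sections -/

namespace GaugeTheory

/-- Every linear map between tangent spaces is the derivative of a smooth map defined locally. -/
theorem exists_contMDiffOn_mfderiv_eq {n l : ℕ} {M E : Type*} [TopologicalSpace M]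
    [ChartedSpace (𝔼 n) M] [IsManifold (𝓡 n) ∞ M] [TopologicalSpace E] [ChartedSpace (𝔼 l) E]
    [IsManifold (𝓡 l) ∞ E] (m : M) (p : E) (u : 𝔼 n →L[ℝ] 𝔼 l) :
    ∃ (U : Set M) (h : M → E), IsOpen U ∧ m ∈ U ∧ ContMDiffOn (𝓡 n) (𝓡 l) ∞ h U ∧ h m = p ∧
      @Eq (𝔼 n →L[ℝ] 𝔼 l) (mfderiv (𝓡 n) (𝓡 l) h m) u := by
  set c := extChartAt (𝓡 n) m with hc
  set c' := extChartAt (𝓡 l) p with hc'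
  -- The affine map with linear part u that sends the coordinates of m to those of p. In the
  -- preferred charts at m and p it represents the required map.
  set A : 𝔼 n → 𝔼 l := fun y => c' p + u (y - c m) with hA
  have hAs : ContDiff ℝ ∞ A := by fun_prop
  have hAm : A (c m) = c' p := by simp [hA]
  set U : Set M := c.source ∩ c ⁻¹' (A ⁻¹' c'.target) with hU
  have hUo : IsOpen U := (continuousOn_extChartAt m).isOpen_inter_preimage
    (isOpen_extChartAt_source m) ((isOpen_extChartAt_target p).preimage hAs.continuous)
  have hmU : m ∈ U := ⟨mem_extChartAt_source m, by
    change A (c m) ∈ c'.target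
    rw [hAm]; exact mem_extChartAt_target p⟩
  have hs : ContMDiffOn (𝓡 n) (𝓡 l) ∞ (fun x => c'.symm (A (c x))) U :=
    (contMDiffOn_extChartAt_symm p).comp (hAs.contMDiff.comp_contMDiffOn
      ((contMDiffOn_extChartAt (x := m)).mono fun x hx => by
        have := hx.1
        rwa [hc, extChartAt_source] at this)) fun x hx => hx.2
  have hm : c'.symm (A (c m)) = p := by rw [hAm]; exact extChartAt_to_inv p
  refine ⟨U, fun x => c'.symm (A (c x)), hUo, hmU, hs, hm, ?_⟩
  have hd : HasMFDerivAt (𝓡 n) (𝓡 l) (fun x => c'.symm (A (c x))) m u := by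
    refine ⟨(hs.continuousOn.continuousAt (hUo.mem_nhds hmU)), ?_⟩
    have hA' : HasFDerivAt A u (c m) := by
      have h1 : HasFDerivAt (fun y => u (y - c m)) u (c m) :=
        (u.hasFDerivAt.comp (c m) ((hasFDerivAt_id (c m)).sub_const (c m)))
      exact h1.const_add (c' p)
    refine (hA'.congr_of_eventuallyEq ?_).hasFDerivWithinAt
    have ht : ∀ᶠ y in 𝓝 (c m), y ∈ c.target :=
      (isOpen_extChartAt_target m).mem_nhds (mem_extChartAt_target m)
    have ht' : ∀ᶠ y in 𝓝 (c m), A y ∈ c'.target :=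
      hAs.continuous.continuousAt.preimage_mem_nhds (by
        rw [hAm]; exact (isOpen_extChartAt_target p).mem_nhds (mem_extChartAt_target p))
    filter_upwards [ht, ht'] with y hy hy'
    simp only [writtenInExtChartAt, Function.comp_apply]
    rw [hm, ← hc, ← hc', c.right_inv hy, c'.right_inv hy']
  exact hd.mfderiv

namespace PrincipalBundle

variable {n d : ℕ} {G M : Type*}
  [TopologicalSpace G] [ChartedSpace (𝔼 d) G] [Group G] [LieGroup (𝓡 d) ∞ G]
  [TopologicalSpace M] [ChartedSpace (𝔼 n) M] [IsManifold (𝓡 n) ∞ M]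
  {B : PrincipalBundle n d G M}

/-- Every point of `JP` is the jet of a smooth local section. -/
theorem exists_isSectionOn_jet_eq {m : M} (w : JetAt B.proj m) :
    ∃ (U : Set M) (hU : IsOpen U) (hm : m ∈ U) (σ : M → B.Carrier) (hσ : IsSectionOn B.proj σ U),
      hσ.jet hU hm = w := by
  obtain ⟨V, h, hV, hmV, hh, hp, hu⟩ := exists_contMDiffOn_mfderiv_eq (n := n) m w.pt w.lin
  set T := B.localTriv m
  have hmT : m ∈ T.base := B.mem_localTriv m
  set U : Set M := (V ∩ h ⁻¹' T.hom.source) ∩ T.base with hUdef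
  have hUo : IsOpen U :=
    (hh.continuousOn.isOpen_inter_preimage hV T.hom.open_source).inter T.isOpen_base
  have hpT : w.pt ∈ T.hom.source := T.mem_source.2 (w.proj_pt.symm ▸ hmT)
  have hmU : m ∈ U := ⟨⟨hmV, by rw [mem_preimage, hp]; exact hpT⟩, hmT⟩
  have hξ : ContMDiffOn (𝓡 n) (𝓡 d) ∞ (fun x => (T.hom (h x)).2) U :=
    contMDiff_snd.comp_contMDiffOn (T.contMDiffOn_hom.comp (hh.mono fun x hx => hx.1.1)
      fun x hx => hx.1.2)
  -- The map h has the right derivative but need not be a section. Only its group coordinate is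
  -- kept, and its base coordinate is replaced by x.
  have hσ : IsSectionOn B.proj (fun x => T.hom.symm (x, (T.hom (h x)).2)) U :=
    { contMDiffOn := T.contMDiffOn_symm.comp (contMDiffOn_id.prodMk hξ)
        fun x hx => T.mem_target.2 hx.2
      proj_eq := fun x hx => by
        have ht : (x, (T.hom (h x)).2) ∈ T.hom.target := T.mem_target.2 hx.2
        rw [← T.fst_hom _ (T.hom.map_target ht), T.hom.right_inv ht] }
  have hback : ∀ x ∈ U, T.hom.symm (B.proj (h x), (T.hom (h x)).2) = h x := fun x hx => by
    rw [← T.fst_hom _ hx.1.2]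
    exact T.hom.left_inv hx.1.2
  refine ⟨U, hUo, hmU, _, hσ, JetAt.ext_model ?_ ?_⟩
  · change T.hom.symm (m, (T.hom (h m)).2) = w.pt
    have h1 := hback m hmU
    rw [hp, w.proj_pt] at h1
    rw [hp, h1]
  · have hhd : MDifferentiableAt (𝓡 n) (𝓡 (n + d)) h m :=
      (hh.contMDiffAt (hV.mem_nhds hmV)).mdifferentiableAt (by simp)
    have hξd : MDifferentiableAt (𝓡 n) (𝓡 d) (fun x => (T.hom (h x)).2) m :=
      (hξ.contMDiffAt (hUo.mem_nhds hmU)).mdifferentiableAt (by simp)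
    have hπd : MDifferentiableAt (𝓡 (n + d)) (𝓡 n) B.proj (h m) :=
      B.proj.contMDiff.mdifferentiableAt (by simp)
    -- The replacement is harmless to first order: since w is a jet, ρ ∘ h fixes m and has the
    -- identity as derivative there.
    have e1 : @Eq (𝔼 n →L[ℝ] 𝔼 n) (mfderiv (𝓡 n) (𝓡 n) (fun x : M => x) m)
        (mfderiv (𝓡 n) (𝓡 n) (fun x => B.proj (h x)) m) := by
      have e2 : @Eq (𝔼 n →L[ℝ] 𝔼 n) (mfderiv (𝓡 n) (𝓡 n) (fun x => B.proj (h x)) m)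
          ((mfderiv (𝓡 (n + d)) (𝓡 n) B.proj (h m) : 𝔼 (n + d) →L[ℝ] 𝔼 n).comp
            (mfderiv (𝓡 n) (𝓡 (n + d)) h m : 𝔼 n →L[ℝ] 𝔼 (n + d))) := mfderiv_comp m hπd hhd
      rw [hu] at e2
      refine Eq.trans ?_ e2.symm
      refine (mfderiv_id : mfderiv (𝓡 n) (𝓡 n) (id : M → M) m = _).trans ?_
      refine ContinuousLinearMap.ext fun v => ?_
      have e3 : ∀ p', p' = w.pt →
          @Eq (𝔼 n) ((mfderiv (𝓡 (n + d)) (𝓡 n) B.proj p' : 𝔼 (n + d) →L[ℝ] 𝔼 n) (w.lin v)) v := by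
        rintro _ rfl; exact w.mfderiv_lin v
      exact (e3 _ hp).symm
    have hm1 : m = B.proj (h m) := by rw [hp, w.proj_pt]
    have hΨ : MDifferentiableAt ((𝓡 n).prod (𝓡 d)) (𝓡 (n + d)) T.hom.symm (m, (T.hom (h m)).2) :=
      (T.contMDiffOn_symm.contMDiffAt (T.hom.open_target.mem_nhds
        (T.mem_target.2 hmT))).mdifferentiableAt (by simp)
    have e4 := mfderiv_prod_eq_of_eq (H := T.hom.symm) (γ₁ := fun x : M => x)
      (γ₂ := fun x => B.proj (h x)) (φ₁ := fun x => (T.hom (h x)).2)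
      (φ₂ := fun x => (T.hom (h x)).2) hm1 rfl e1 rfl mdifferentiableAt_id (hπd.comp m hhd) hξd hξd hΨ
    refine e4.trans (Eq.trans (mfderiv_eq_of_eventuallyEq ?_) hu)
    filter_upwards [hUo.mem_nhds hmU] with x hx using hback x hx

end PrincipalBundle
end GaugeTheory

/-! ### The flat connection defined by a local section -/

namespace GaugeTheory

/-- A finite linear combination of smooth vector fields along a smooth map is smooth. -/
theorem contMDiffAt_sum_smul_along {VX HX X VE HE E ι : Type*}
    [NormedAddCommGroup VX] [NormedSpace ℝ VX] [TopologicalSpace HX] {IX : ModelWithCorners ℝ VX HX}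
    [TopologicalSpace X] [ChartedSpace HX X]
    [NormedAddCommGroup VE] [NormedSpace ℝ VE] [TopologicalSpace HE] {IE : ModelWithCorners ℝ VE HE}
    [TopologicalSpace E] [ChartedSpace HE E] [IsManifold IE ∞ E] {s : X → E} {x₀ : X}
    (hs : ContMDiffAt IX IE ∞ s x₀) (I : Finset ι) {c : ι → X → ℝ} {u : ι → X → VE}
    (hc : ∀ i ∈ I, ContMDiffAt IX 𝓘(ℝ, ℝ) ∞ (c i) x₀)
    (hu : ∀ i ∈ I, ContMDiffAt IX IE.tangent ∞
      (fun x => (⟨s x, u i x⟩ : TangentBundle IE E)) x₀) :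
    ContMDiffAt IX IE.tangent ∞
      (fun x => (⟨s x, ((∑ i ∈ I, c i x • u i x : VE) : TangentSpace IE (s x))⟩ :
        TangentBundle IE E)) x₀ := by
  rw [Bundle.contMDiffAt_totalSpace]
  refine ⟨hs, ?_⟩
  set t := trivializationAt VE (TangentSpace IE : E → Type _) (s x₀) with ht
  have h1 : ContMDiffAt IX 𝓘(ℝ, VE) ∞
      (fun x => ∑ i ∈ I, c i x • (t (⟨s x, u i x⟩ : TangentBundle IE E)).2) x₀ :=
    ContMDiffAt.sum fun i hi => (hc i hi).smul ((Bundle.contMDiffAt_totalSpace).1 (hu i hi)).2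
  refine h1.congr_of_eventuallyEq ?_
  filter_upwards [hs.continuousAt.preimage_mem_nhds (t.open_baseSet.mem_nhds
    (mem_baseSet_trivializationAt VE (TangentSpace IE : E → Type _) (s x₀)))] with x hx
  obtain ⟨L, hL⟩ : ∃ L : VE →L[ℝ] VE, L = t.continuousLinearMapAt ℝ (s x) := ⟨_, rfl⟩
  have e1 : ∀ v : VE, (t (⟨s x, v⟩ : TangentBundle IE E)).2 = L v := fun v => by
    rw [hL]
    exact (Bundle.Trivialization.continuousLinearMapAt_apply_of_mem ℝ t hx v).symm
  refine (e1 _).trans ((map_sum L _ _).trans ?_)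
  exact Finset.sum_congr rfl fun i _ => (map_smul L _ _).trans (congrArg _ (e1 _).symm)

/-- The tangent map of a smooth map on an open set is smooth over this set. -/
theorem contMDiffOn_tangentMap_of_isOpen {VX HX X VE HE E : Type*}
    [NormedAddCommGroup VX] [NormedSpace ℝ VX] [TopologicalSpace HX] {IX : ModelWithCorners ℝ VX HX}
    [TopologicalSpace X] [ChartedSpace HX X] [IsManifold IX ∞ X]
    [NormedAddCommGroup VE] [NormedSpace ℝ VE] [TopologicalSpace HE] {IE : ModelWithCorners ℝ VE HE}
    [TopologicalSpace E] [ChartedSpace HE E] [IsManifold IE ∞ E] {f : X → E} {U : Set X}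
    (hU : IsOpen U) (hf : ContMDiffOn IX IE ∞ f U) :
    ContMDiffOn IX.tangent IE.tangent ∞ (tangentMap IX IE f) (Bundle.TotalSpace.proj ⁻¹' U) := by
  refine (hf.contMDiffOn_tangentMapWithin (m := ∞) (by simp) hU.uniqueMDiffOn).congr ?_
  intro v hv
  exact (tangentMapWithin_eq_tangentMap (hU.uniqueMDiffOn _ hv)
    ((hf.contMDiffAt (hU.mem_nhds hv)).mdifferentiableAt (by simp))).symm

namespace PrincipalBundle

variable {n d : ℕ} {G M : Type*}
  [TopologicalSpace G] [ChartedSpace (𝔼 d) G] [Group G] [LieGroup (𝓡 d) ∞ G]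
  [TopologicalSpace M] [ChartedSpace (𝔼 n) M] [IsManifold (𝓡 n) ∞ M]
  {B : PrincipalBundle n d G M}

/-- The derivative of the right translation by `g` at `p`, as a map of model spaces. -/
noncomputable def translationDeriv (B : PrincipalBundle n d G M) (g : G) (p : B.Carrier) :
    𝔼 (n + d) →L[ℝ] 𝔼 (n + d) :=
  mfderiv (𝓡 (n + d)) (𝓡 (n + d)) (B.rightTranslation g) p

theorem mdifferentiableAt_rightTranslation (g : G) (p : B.Carrier) :
    MDifferentiableAt (𝓡 (n + d)) (𝓡 (n + d)) (B.rightTranslation g) p :=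
  (B.rightTranslation g).contMDiff.mdifferentiableAt (by simp)

theorem translationDeriv_one (p : B.Carrier) :
    B.translationDeriv 1 p = ContinuousLinearMap.id ℝ _ := by
  have h : (B.rightTranslation 1 : B.Carrier → B.Carrier) = id := funext B.act_one
  have h2 : @Eq (𝔼 (n + d) →L[ℝ] 𝔼 (n + d))
      (mfderiv (𝓡 (n + d)) (𝓡 (n + d)) (B.rightTranslation 1) p)
      (mfderiv (𝓡 (n + d)) (𝓡 (n + d)) (id : B.Carrier → B.Carrier) p) := by rw [h]
  exact h2.trans mfderiv_id

theorem translationDeriv_mul (g h : G) (p : B.Carrier) :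
    B.translationDeriv (g * h) p =
      (B.translationDeriv h (B.act p g)).comp (B.translationDeriv g p) := by
  have e : (B.rightTranslation (g * h) : B.Carrier → B.Carrier) =
      B.rightTranslation h ∘ B.rightTranslation g := funext fun p => B.act_mul p g h
  have h2 : @Eq (𝔼 (n + d) →L[ℝ] 𝔼 (n + d))
      (mfderiv (𝓡 (n + d)) (𝓡 (n + d)) (B.rightTranslation (g * h)) p)
      (mfderiv (𝓡 (n + d)) (𝓡 (n + d)) (B.rightTranslation h ∘ B.rightTranslation g) p) := by rw [e]
  exact h2.trans (mfderiv_comp p (mdifferentiableAt_rightTranslation h _)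
    (mdifferentiableAt_rightTranslation g p))

/-- The derivative of the projection, as a map of model spaces. -/
noncomputable def projDeriv (B : PrincipalBundle n d G M) (p : B.Carrier) : 𝔼 (n + d) →L[ℝ] 𝔼 n :=
  mfderiv (𝓡 (n + d)) (𝓡 n) B.proj p

theorem projDeriv_translationDeriv (g : G) (p : B.Carrier) (v : 𝔼 (n + d)) :
    B.projDeriv (B.act p g) (B.translationDeriv g p v) = B.projDeriv p v := by
  have e : B.proj ∘ B.rightTranslation g = B.proj := funext fun p => B.proj_act' p g
  have h1 := mfderiv_comp p (g := B.proj) (f := B.rightTranslation g)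
    (I := 𝓡 (n + d)) (I' := 𝓡 (n + d)) (I'' := 𝓡 n)
    (B.proj.contMDiff.mdifferentiableAt (by simp)) (mdifferentiableAt_rightTranslation g p)
  have h2 : @Eq (𝔼 (n + d) →L[ℝ] 𝔼 n) (mfderiv (𝓡 (n + d)) (𝓡 n) B.proj p)
      (mfderiv (𝓡 (n + d)) (𝓡 n) (B.proj ∘ B.rightTranslation g) p) := by rw [e]
  exact (congrArg (fun L : 𝔼 (n + d) →L[ℝ] 𝔼 n => L v) (h2.trans h1)).symm

open Classical in
/-- The horizontal lift at `p` defined by the flat connection of a local section `σ`. -/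
noncomputable def sectionLift (σ : M → B.Carrier) (p : B.Carrier) : 𝔼 n →L[ℝ] 𝔼 (n + d) :=
  if h : ∃ g, B.act (σ (B.proj p)) g = p then
    (B.translationDeriv h.choose (σ (B.proj p))).comp
      (mfderiv (𝓡 n) (𝓡 (n + d)) σ (B.proj p))
  else 0

/-- The action is free, so the chosen group element is the only possible one. The point x is
separate from the projection of p, since in applications they are equal only propositionally. -/
theorem sectionLift_eq {σ : M → B.Carrier} {x : M} {g : G} {p : B.Carrier} (hx : B.proj p = x)
    (h : B.act (σ x) g = p) :
    sectionLift σ p = (B.translationDeriv g (σ x)).comp (mfderiv (𝓡 n) (𝓡 (n + d)) σ x) := by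
  subst hx
  have h' : ∃ g, B.act (σ (B.proj p)) g = p := ⟨g, h⟩
  rw [sectionLift, dif_pos h', B.act_injective _ (h'.choose_spec.trans h.symm)]
  rfl

variable {σ : M → B.Carrier} {V : Set M}

theorem exists_act_section_eq (hσ : IsSectionOn B.proj σ V) {p : B.Carrier} (hp : B.proj p ∈ V) :
    ∃ g, B.act (σ (B.proj p)) g = p := B.exists_act_eq (hσ.proj_eq _ hp)

/-- If σ · g = p then σ · (gh) = p · h, and the chain rule for right translations gives the
equivariance required of a connection. -/
theorem sectionLift_act (hσ : IsSectionOn B.proj σ V) {p : B.Carrier} (hp : B.proj p ∈ V) (h : G) :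
    sectionLift σ (B.act p h) = (B.translationDeriv h p).comp (sectionLift σ p) := by
  obtain ⟨g, hg⟩ := exists_act_section_eq hσ hp
  rw [sectionLift_eq (g := g * h) (B.proj_act' p h) (by rw [B.act_mul, hg]),
    sectionLift_eq rfl hg, translationDeriv_mul, hg]
  rfl

theorem sectionLift_self (hσ : IsSectionOn B.proj σ V) {x : M} (hx : x ∈ V) :
    sectionLift σ (σ x) = mfderiv (𝓡 n) (𝓡 (n + d)) σ x := by
  rw [sectionLift_eq (g := 1) (hσ.proj_eq x hx) (B.act_one _), translationDeriv_one]
  rfl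

/-- Right translations preserve the fibres, so the claim reduces to σ being a section. -/
theorem projDeriv_sectionLift (hσ : IsSectionOn B.proj σ V) (hV : IsOpen V) {p : B.Carrier}
    (hp : B.proj p ∈ V) (v : 𝔼 n) : B.projDeriv p (sectionLift σ p v) = v := by
  obtain ⟨g, hg⟩ := exists_act_section_eq hσ hp
  rw [sectionLift_eq rfl hg]
  conv_lhs => rw [← hg]
  have h := projDeriv_translationDeriv g (σ (B.proj p))
    ((mfderiv (𝓡 n) (𝓡 (n + d)) σ (B.proj p) : 𝔼 n →L[ℝ] 𝔼 (n + d)) v)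
  rw [hg] at h ⊢
  exact h.trans ((hσ.jet hV hp).mfderiv_lin v)

/-- The horizontal lift of the flat connection of a local section is smooth along any local
trivialization. -/
theorem contMDiffOn_sectionLift (hσ : IsSectionOn B.proj σ V) (hV : IsOpen V) (T : B.LocalTriv) :
    ContMDiffOn (𝓡 n).tangent (𝓡 (n + d)).tangent ∞
      (fun v : TangentBundle (𝓡 n) M =>
        (⟨T.sec v.1, sectionLift σ (T.sec v.1) v.2⟩ : TangentBundle (𝓡 (n + d)) B.Carrier))
      (Bundle.TotalSpace.proj ⁻¹' (V ∩ T.base)) := by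
  -- The group element that moves σ(x) to the section of the trivialization.
  set a : M → G := fun x => (T.hom (σ x)).2⁻¹ with ha
  have hσT : ∀ x ∈ V ∩ T.base, σ x ∈ T.hom.source := fun x hx =>
    T.mem_source.2 (by rw [hσ.proj_eq x hx.1]; exact hx.2)
  have has : ContMDiffOn (𝓡 n) (𝓡 d) ∞ a (V ∩ T.base) :=
    ContMDiffOn.inv (contMDiff_snd.comp_contMDiffOn (T.contMDiffOn_hom.comp
      (hσ.contMDiffOn.mono inter_subset_left) hσT))
  have hact : ∀ x ∈ V ∩ T.base, B.act (σ x) (a x) = T.sec x := fun x hx => by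
    conv_lhs => rw [← T.act_sec (hσT x hx), hσ.proj_eq x hx.1, ← B.act_mul]
    simp only [ha, mul_inv_cancel, act_one]
  have hW : IsOpen (V ∩ T.base) := hV.inter T.isOpen_base
  have h1 : ContMDiffOn (𝓡 n).tangent (𝓡 (n + d)).tangent ∞ (tangentMap (𝓡 n) (𝓡 (n + d)) σ)
      (Bundle.TotalSpace.proj ⁻¹' (V ∩ T.base)) :=
    contMDiffOn_tangentMap_of_isOpen hW (hσ.contMDiffOn.mono inter_subset_left)
  have h2 : ContMDiffOn (𝓡 n).tangent (𝓡 d).tangent ∞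
      (fun v : TangentBundle (𝓡 n) M => (⟨a v.1, 0⟩ : TangentBundle (𝓡 d) G))
      (Bundle.TotalSpace.proj ⁻¹' (V ∩ T.base)) :=
    (Bundle.contMDiff_zeroSection ℝ (TangentSpace (𝓡 d) : G → Type _)).comp_contMDiffOn
      (has.comp (Bundle.contMDiff_proj (TangentSpace (𝓡 n) : M → Type _)).contMDiffOn
        fun v hv => hv)
  -- Translating a tangent vector by a(x) without differentiating a amounts to applying the tangent
  -- map of the action P × G → P to that vector paired with the zero vector at a(x). This displays
  -- the lift as a composition of smooth maps.
  have h3 : ContMDiff ((𝓡 (n + d)).prod (𝓡 d)).tangent (𝓡 (n + d)).tangent ∞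
      (tangentMap ((𝓡 (n + d)).prod (𝓡 d)) (𝓡 (n + d)) fun x : B.Carrier × G => B.act x.1 x.2) :=
    B.contMDiff_act'.contMDiff_tangentMap (by simp)
  have h4 := h3.comp_contMDiffOn ((contMDiff_equivTangentBundleProd_symm (n := ∞)
    (I := 𝓡 (n + d)) (M := B.Carrier) (I' := 𝓡 d) (M' := G)).comp_contMDiffOn (h1.prodMk h2))
  refine h4.congr fun v hv => ?_
  have e1 : sectionLift σ (T.sec v.1) =
      (B.translationDeriv (a v.1) (σ v.1)).comp (mfderiv (𝓡 n) (𝓡 (n + d)) σ v.1) :=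
    sectionLift_eq (T.proj_sec hv.2) (hact _ hv)
  have e2 : ∀ u : 𝔼 (n + d), B.translationDeriv (a v.1) (σ v.1) u =
      (mfderiv ((𝓡 (n + d)).prod (𝓡 d)) (𝓡 (n + d)) (fun x : B.Carrier × G => B.act x.1 x.2)
        (σ v.1, a v.1) : 𝔼 (n + d) × 𝔼 d →L[ℝ] 𝔼 (n + d)) (u, 0) := by
    intro u
    have h5 := mfderiv_comp (σ v.1) (I := 𝓡 (n + d)) (I' := (𝓡 (n + d)).prod (𝓡 d))
      (I'' := 𝓡 (n + d)) (g := fun x : B.Carrier × G => B.act x.1 x.2)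
      (f := fun p : B.Carrier => (p, a v.1))
      (B.contMDiff_act'.mdifferentiableAt (by simp))
      (mdifferentiableAt_id.prodMk mdifferentiableAt_const)
    rw [mfderiv_prod_left] at h5
    exact congrArg (fun L : 𝔼 (n + d) →L[ℝ] 𝔼 (n + d) => L u) h5
  have e3 : ∀ (p p' : B.Carrier) (u u' : 𝔼 (n + d)), p = p' → u = u' →
      (⟨p, u⟩ : TangentBundle (𝓡 (n + d)) B.Carrier) = ⟨p', u'⟩ := by rintro _ _ _ _ rfl rfl; rfl
  refine e3 _ _ _ _ (hact _ hv).symm ?_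
  rw [e1]
  exact e2 _

end PrincipalBundle
end GaugeTheory

/-! ### Gluing flat connections to a global principal connection -/

namespace GaugeTheory
namespace PrincipalBundle

variable {n d : ℕ} {G M : Type*}
  [TopologicalSpace G] [ChartedSpace (𝔼 d) G] [Group G] [LieGroup (𝓡 d) ∞ G]
  [TopologicalSpace M] [ChartedSpace (𝔼 n) M] [IsManifold (𝓡 n) ∞ M]
  {B : PrincipalBundle n d G M}

section Glue

variable {ι : Type*} {ρ : SmoothPartitionOfUnity ι (𝓡 n) M univ} {τ : ι → M → B.Carrier}
  {V : ι → Set M}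

/-- The horizontal lift obtained by gluing the flat connections of local sections. -/
noncomputable def glueLift (ρ : SmoothPartitionOfUnity ι (𝓡 n) M univ) (τ : ι → M → B.Carrier)
    (p : B.Carrier) : 𝔼 n →L[ℝ] 𝔼 (n + d) :=
  ∑ i ∈ ρ.finsupport (B.proj p), ρ i (B.proj p) • sectionLift (τ i) p

theorem mem_of_mem_finsupport (hρ : ρ.IsSubordinate V) {x : M} {i : ι} (hi : i ∈ ρ.finsupport x) :
    x ∈ V i :=
  hρ i (subset_tsupport _ (by simpa [ρ.mem_finsupport] using hi))

/-- The weights depend only on the base point, and each flat lift with nonzero weight is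
equivariant. -/
theorem glueLift_act (hρ : ρ.IsSubordinate V) (hτ : ∀ i, IsSectionOn B.proj (τ i) (V i))
    (p : B.Carrier) (h : G) :
    glueLift ρ τ (B.act p h) = (B.translationDeriv h p).comp (glueLift ρ τ p) := by
  have hs : ∀ x, x = B.proj p → ∑ i ∈ ρ.finsupport x, ρ i x • sectionLift (τ i) (B.act p h) =
      (B.translationDeriv h p).comp (glueLift ρ τ p) := by
    rintro _ rfl
    refine ContinuousLinearMap.ext fun v => ?_
    simp only [glueLift, sum_apply, smul_apply,
      ContinuousLinearMap.comp_apply, map_sum, map_smul]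
    refine Finset.sum_congr rfl fun i hi => ?_
    rw [sectionLift_act (hτ i) (mem_of_mem_finsupport hρ hi)]
    rfl
  exact hs _ (B.proj_act' p h)

/-- Horizontal lifts form an affine space, and the weights sum to one. -/
theorem projDeriv_glueLift (hρ : ρ.IsSubordinate V) (hV : ∀ i, IsOpen (V i))
    (hτ : ∀ i, IsSectionOn B.proj (τ i) (V i)) (p : B.Carrier) (v : 𝔼 n) :
    B.projDeriv p (glueLift ρ τ p v) = v := by
  simp only [glueLift, sum_apply, smul_apply, map_sum,
    map_smul]
  rw [Finset.sum_congr rfl fun i hi => by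
    rw [projDeriv_sectionLift (hτ i) (hV i) (mem_of_mem_finsupport hρ hi)],
    ← Finset.sum_smul, ρ.sum_finsupport _ (mem_univ _), one_smul]

/-- The index set of the sum varies with the point. Near a given base point it lies in a fixed
finite set of indices whose supports contain that point, so the corresponding local sections are all
defined nearby. -/
theorem contMDiffOn_glueLift (hρ : ρ.IsSubordinate V) (hV : ∀ i, IsOpen (V i))
    (hτ : ∀ i, IsSectionOn B.proj (τ i) (V i)) (T : B.LocalTriv) :
    ContMDiffOn (𝓡 n).tangent (𝓡 (n + d)).tangent ∞
      (fun v : TangentBundle (𝓡 n) M =>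
        (⟨T.sec v.1, glueLift ρ τ (T.sec v.1) v.2⟩ : TangentBundle (𝓡 (n + d)) B.Carrier))
      (Bundle.TotalSpace.proj ⁻¹' T.base) := by
  intro v₀ hv₀
  apply ContMDiffAt.contMDiffWithinAt
  have hproj : ContMDiff (𝓡 n).tangent (𝓡 n) ∞
      (Bundle.TotalSpace.proj : TangentBundle (𝓡 n) M → M) :=
    Bundle.contMDiff_proj (TangentSpace (𝓡 n) : M → Type _)
  have hs : ContMDiffAt (𝓡 n).tangent (𝓡 (n + d)) ∞
      (fun v : TangentBundle (𝓡 n) M => T.sec v.1) v₀ :=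
    (T.contMDiffOn_sec.contMDiffAt (T.isOpen_base.mem_nhds hv₀)).comp v₀ hproj.contMDiffAt
  have h1 := contMDiffAt_sum_smul_along hs (ρ.fintsupport v₀.1) (c := fun i v => ρ i v.1)
    (u := fun i v => sectionLift (τ i) (T.sec v.1) v.2)
    (fun i _ => (ρ i).contMDiff.contMDiffAt.comp v₀ hproj.contMDiffAt)
    (fun i hi => (contMDiffOn_sectionLift (hτ i) (hV i) T).contMDiffAt
      ((((hV i).inter T.isOpen_base).preimage hproj.continuous).mem_nhds
        ⟨hρ i ((ρ.mem_fintsupport_iff _ i).1 hi), hv₀⟩))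
  refine h1.congr_of_eventuallyEq ?_
  filter_upwards [hproj.continuous.continuousAt.eventually
    (ρ.eventually_finsupport_subset v₀.1), hproj.continuous.continuousAt.preimage_mem_nhds
      (T.isOpen_base.mem_nhds hv₀)] with v hv hvT
  refine congrArg (fun u : 𝔼 (n + d) =>
    (⟨T.sec v.1, u⟩ : TangentBundle (𝓡 (n + d)) B.Carrier)) ?_
  have h2 : glueLift ρ τ (T.sec v.1) =
      ∑ i ∈ ρ.finsupport v.1, ρ i v.1 • sectionLift (τ i) (T.sec v.1) := by
    rw [glueLift, T.proj_sec hvT]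
  have h3 : ∀ u : 𝔼 n, glueLift ρ τ (T.sec v.1) u =
      ∑ i ∈ ρ.finsupport v.1, ρ i v.1 • sectionLift (τ i) (T.sec v.1) u := fun u => by
    rw [h2, sum_apply]; rfl
  refine (h3 v.2).trans ?_
  refine Finset.sum_subset hv fun i _ hi => ?_
  have h0 : ρ i v.1 = 0 := by
    by_contra h0
    exact hi ((ρ.mem_finsupport _).2 h0)
  simp [h0]

/-- The element of `JP` at `p` given by the glued horizontal lift. -/
noncomputable def glueJet (hρ : ρ.IsSubordinate V) (hV : ∀ i, IsOpen (V i))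
    (hτ : ∀ i, IsSectionOn B.proj (τ i) (V i)) {x : M} {p : B.Carrier} (hp : B.proj p = x) :
    JetAt B.proj x where
  pt := p
  proj_pt := hp
  lin := glueLift ρ τ p
  mfderiv_lin := projDeriv_glueLift hρ hV hτ p

/-- Equivariance of the glued lift puts its values at all points of a fibre into one orbit, so they
define a single point of CP. -/
theorem mk_glueJet_eq (hρ : ρ.IsSubordinate V) (hV : ∀ i, IsOpen (V i))
    (hτ : ∀ i, IsSectionOn B.proj (τ i) (V i)) {x : M} {p p' : B.Carrier} (hp : B.proj p = x)
    (hp' : B.proj p' = x) :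
    ConnectionAt.mk (glueJet hρ hV hτ hp) = ConnectionAt.mk (glueJet hρ hV hτ hp') := by
  obtain ⟨g, rfl⟩ := B.exists_act_eq (hp.trans hp'.symm)
  refine Quotient.sound ⟨g, JetAt.ext_model rfl ?_⟩
  exact glueLift_act hρ hτ p g

/-- The principal connection obtained by gluing the flat connections of local sections. -/
noncomputable def glueConnection (hρ : ρ.IsSubordinate V) (hV : ∀ i, IsOpen (V i))
    (hτ : ∀ i, IsSectionOn B.proj (τ i) (V i)) : B.Connection where
  toFun x := ConnectionAt.mk
    (glueJet hρ hV hτ ((B.localTriv x).proj_sec (B.mem_localTriv x)))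
  smooth m := by
    classical
    set T := B.localTriv m
    -- A lift to JP is needed at every point of M, so outside the domain of T an arbitrary point of
    -- the fibre is used; smoothness is only claimed inside.
    have hp : ∀ x, B.proj (if x ∈ T.base then T.sec x else (B.localTriv x).sec x) = x := by
      intro x
      split_ifs with h
      · exact T.proj_sec h
      · exact (B.localTriv x).proj_sec (B.mem_localTriv x)
    refine ⟨T.base, T.isOpen_base, B.mem_localTriv m, fun x => glueJet hρ hV hτ (hp x),
      fun x _ => mk_glueJet_eq hρ hV hτ _ _, ?_⟩
    refine (contMDiffOn_glueLift hρ hV hτ T).congr fun v hv => ?_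
    have e : ∀ p, p = T.sec v.1 → (⟨p, glueLift ρ τ p v.2⟩ : TangentBundle (𝓡 (n + d)) B.Carrier) =
        ⟨T.sec v.1, glueLift ρ τ (T.sec v.1) v.2⟩ := by rintro _ rfl; rfl
    exact e _ (if_pos hv)

end Glue

/-- Every jet of a local section of a principal bundle is the value of a principal connection. -/
theorem exists_connection_eq_mk_jet [T2Space M] [SigmaCompactSpace M] {σ : M → B.Carrier}
    {U : Set M} (hσ : IsSectionOn B.proj σ U) (hU : IsOpen U) {m : M} (hm : m ∈ U) :
    ∃ A : B.Connection, A.toFun m = ConnectionAt.mk (hσ.jet hU hm) := by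
  -- The cover is indexed by the points of M and arranged so that only the member with index m
  -- contains m. At m the partition function with that index is then 1, and the glued connection is
  -- the flat connection of σ there.
  have hex : ∀ i : M, ∃ (V : Set M) (τ : M → B.Carrier), IsOpen V ∧ i ∈ V ∧
      IsSectionOn B.proj τ V ∧ (i ≠ m → m ∉ V) ∧ (i = m → τ = σ) := by
    intro i
    by_cases hi : i = m
    · subst hi
      exact ⟨U, σ, hU, hm, hσ, fun h => absurd rfl h, fun _ => rfl⟩
    · set T := B.localTriv i
      refine ⟨T.base \ {m}, T.sec, T.isOpen_base.sdiff isClosed_singleton,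
        ⟨B.mem_localTriv i, hi⟩, ⟨T.contMDiffOn_sec.mono sdiff_subset,
          fun x hx => T.proj_sec hx.1⟩, fun _ h => h.2 rfl, fun h => absurd h hi⟩
  choose V τ hV hiV hτ hne heq using hex
  obtain ⟨ρ, hρ⟩ := SmoothPartitionOfUnity.exists_isSubordinate (𝓡 n) isClosed_univ V hV
    fun x _ => mem_iUnion.2 ⟨x, hiV x⟩
  refine ⟨glueConnection hρ hV hτ, ?_⟩
  have hmp : B.proj (σ m) = m := hσ.proj_eq m hm
  refine (mk_glueJet_eq hρ hV hτ _ hmp).trans (congrArg ConnectionAt.mk (JetAt.ext_model rfl ?_))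
  change glueLift ρ τ (σ m) = mfderiv (𝓡 n) (𝓡 (n + d)) σ m
  have hsub : ρ.finsupport m ⊆ {m} := fun i hi => by
    by_contra h
    exact hne i (by simpa using h) (mem_of_mem_finsupport hρ hi)
  have hsum : ρ m m = 1 := by
    have h1 := ρ.sum_finsupport' m (mem_univ m) hsub
    simpa using h1
  have h2 : ρ.finsupport m = {m} :=
    subset_antisymm hsub (by
      rw [Finset.singleton_subset_iff, ρ.mem_finsupport]
      simp [hsum])
  rw [glueLift, hmp, h2, Finset.sum_singleton, hsum, one_smul, heq m rfl]
  exact sectionLift_self hσ hm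

end PrincipalBundle
end GaugeTheory

/-! ### The two implications -/

namespace GaugeTheory

theorem IsSectionOn.mono {n : ℕ} {M VE HE E : Type*} [TopologicalSpace M] [ChartedSpace (𝔼 n) M]
    [IsManifold (𝓡 n) ∞ M] [NormedAddCommGroup VE] [NormedSpace ℝ VE] [TopologicalSpace HE]
    {IE : ModelWithCorners ℝ VE HE} [TopologicalSpace E] [ChartedSpace HE E] [IsManifold IE ∞ E]
    {π : C^∞⟮IE, E; 𝓡 n, M⟯} {φ : M → E} {U V : Set M} (h : IsSectionOn π φ U) (hV : V ⊆ U) :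
    IsSectionOn π φ V :=
  ⟨h.contMDiffOn.mono hV, fun x hx => h.proj_eq x (hV hx)⟩

namespace PrincipalBundle

variable {n d k : ℕ} {G M : Type*}
  [TopologicalSpace G] [ChartedSpace (𝔼 d) G] [Group G] [LieGroup (𝓡 d) ∞ G]
  [TopologicalSpace M] [ChartedSpace (𝔼 n) M] [IsManifold (𝓡 n) ∞ M]
  {B : PrincipalBundle n d G M}
  {Q : Type*} [MulAction G Q] [TopologicalSpace Q] [ChartedSpace (𝔼 k) Q]
  [IsManifold (𝓡 k) ∞ Q] [ContMDiffSMul (𝓡 d) (𝓡 k) ∞ G Q]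

/-- The jet of `f ∘ φ` arises from the jet of `φ` by the action of the jet of the section of the
gauge group bundle corresponding to `f`. -/
theorem GaugeTransformation.jetActs_mapSection (f : B.GaugeTransformation)
    (φ : GlobalSection (B.matterProj k Q)) (m : M) :
    JetActs B.gaugeActAssoc (f.toSection.jet m) (φ.jet m) ((f.mapSection φ).jet m) := by
  have e : (fun x => B.gaugeActAssoc (f.toSection.toFun x) (φ.toFun x)) =
      (f.mapSection φ).toFun := by
    funext x
    have h := f.gaugeActAssoc_toSection (φ.toFun x)
    rw [show Assoc.projFun (φ.toFun x) = x from φ.isSectionOn.proj_eq x (mem_univ x)] at h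
    exact h
  refine ⟨univ, isOpen_univ, mem_univ m, f.toSection.toFun, φ.toFun, f.toSection.isSectionOn,
    φ.isSectionOn, e ▸ (f.mapSection φ).isSectionOn, rfl, rfl, ?_⟩
  exact IsSectionOn.jet_eq_of_eventuallyEq _ _ _ _ _ _ (Filter.Eventually.of_forall (congrFun e))

/-- The jet of `f ∘ σ` arises from the jet of `σ` by the action of the jet of the section of the
gauge group bundle corresponding to `f`. -/
theorem GaugeTransformation.jetActs_jetMap (f : B.GaugeTransformation) {m : M}
    (w : JetAt B.proj m) : JetActs B.gaugeAct (f.toSection.jet m) w (f.jetMap w) := by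
  -- The jet action is phrased through local sections, so w first has to be represented by one.
  obtain ⟨U, hU, hm, σ, hσ, rfl⟩ := exists_isSectionOn_jet_eq w
  have hfσ : IsSectionOn B.proj (fun x => f.toContMDiffMap (σ x)) U :=
    ⟨f.toContMDiffMap.contMDiff.comp_contMDiffOn hσ.contMDiffOn,
      fun x hx => (f.proj_map _).trans (hσ.proj_eq x hx)⟩
  have e : ∀ x ∈ U, B.gaugeAct (f.toSection.toFun x) (σ x) = f.toContMDiffMap (σ x) := by
    intro x hx
    have h := f.gaugeAct_toSection (σ x)
    rw [hσ.proj_eq x hx] at h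
    exact h
  refine ⟨U, hU, hm, f.toSection.toFun, σ, f.toSection.isSectionOn.mono (subset_univ U), hσ,
    ⟨hfσ.contMDiffOn.congr e, fun x hx => by rw [e x hx]; exact hfσ.proj_eq x hx⟩, ?_, rfl, ?_⟩
  · exact IsSectionOn.jet_eq_of_eventuallyEq _ _ _ _ _ _ Filter.EventuallyEq.rfl
  · refine Eq.trans ?_ (hσ.map_jet hU hm f.toContMDiffMap f.proj_map hfσ).symm
    exact IsSectionOn.jet_eq_of_eventuallyEq _ _ _ _ _ _ (by
      filter_upwards [hU.mem_nhds hm] with x hx using e x hx)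

/-- Under the connectedness hypothesis, every germ of a local section of the gauge group bundle is
the germ of a gauge transformation. -/
theorem exists_gaugeTransformation_eventually_eq [T2Space M]
    (hG : ∀ (p : B.Carrier) (g : G), ∃ f : B.GaugeTransformation, ∃ g' ∈ connectedComponent g,
      f.toDiffeomorph p = B.act p g')
    {γ : M → B.GaugeBundle} {U : Set M} (hU : IsOpen U) (hγ : IsSectionOn B.gaugeProj γ U) {m : M}
    (hm : m ∈ U) : ∃ f : B.GaugeTransformation, ∀ᶠ x in 𝓝 m,
      (∀ p, B.proj p = x → f.toDiffeomorph p = B.gaugeAct (γ x) p) ∧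
      ∀ e : B.Assoc Q, Assoc.projFun e = x → f.assocFun e = B.gaugeActAssoc (γ x) e := by
  obtain ⟨γ', hγ'⟩ := exists_globalSection_eventuallyEq
    (exists_gaugeSection_mem_connectedComponent hG) hU hγ hm
  refine ⟨GaugeSection.toGaugeTransformation γ', ?_⟩
  filter_upwards [hγ'] with x hx
  refine ⟨fun p hp => ?_, fun e he => ?_⟩
  · rw [GaugeSection.toGaugeTransformation_apply, hp, hx]
  · rw [GaugeSection.assocFun_toGaugeTransformation, he, hx]

variable [T2Space M] [SigmaCompactSpace M] [OrientedAtlas n M]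

theorem MatterLagrangian.IsInvariant.isGaugeInvariant {L : B.MatterLagrangian k Q}
    (hL : L.IsInvariant) : L.IsGaugeInvariant := fun K _ f φ =>
  congrArg (integralForm K) (funext fun m => hL m _ _ _ (f.jetActs_mapSection φ m))

theorem CoupledLagrangian.IsInvariant.isGaugeInvariant {L : B.CoupledLagrangian k Q}
    (hL : L.IsInvariant) : L.IsGaugeInvariant := fun K _ f A φ =>
  congrArg (integralForm K) (funext fun m => by
    obtain ⟨w, hw⟩ := Quotient.exists_rep (A.toFun m)
    refine hL m _ _ _ _ _ ⟨w, f.jetMap w, f.jetActs_jetMap w, hw.symm, ?_⟩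
      (f.jetActs_mapSection φ m)
    change f.connectionMap (A.toFun m) = _
    rw [← hw]
    rfl)

/-- The local sections representing the two jets are replaced by a gauge transformation and a global
section with the same germs at m. The claim is then the pointwise invariance along global fields. -/
theorem MatterLagrangian.IsGaugeInvariant.isInvariant {L : B.MatterLagrangian k Q}
    (hG : ∀ (p : B.Carrier) (g : G), ∃ f : B.GaugeTransformation, ∃ g' ∈ connectedComponent g,
      f.toDiffeomorph p = B.act p g')
    (hQ : ∀ (p : B.Carrier) (q : Q), ∃ φ : GlobalSection (B.matterProj k Q),
      ∃ q' ∈ connectedComponent q, φ.toFun (B.proj p) = Assoc.mk p q')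
    (hL : L.IsGaugeInvariant) : L.IsInvariant := by
  rintro m a b b' ⟨U, hU, hm, γ, φ, hγ, hφ, hγφ, rfl, rfl, rfl⟩
  obtain ⟨f, hf⟩ := exists_gaugeTransformation_eventually_eq (Q := Q) hG hU hγ hm
  obtain ⟨ψ, hψ⟩ := exists_globalSection_eventuallyEq hQ hU hφ hm
  have h1 : ψ.jet m = hφ.jet hU hm := IsSectionOn.jet_eq_of_eventuallyEq _ _ _ _ _ _ hψ
  have h2 : (f.mapSection ψ).jet m = hγφ.jet hU hm := by
    refine IsSectionOn.jet_eq_of_eventuallyEq _ _ _ _ _ _ ?_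
    filter_upwards [hf, hψ] with x hx hx'
    rw [← hx']
    exact hx.2 _ (ψ.isSectionOn.proj_eq x (mem_univ x))
  rw [← h1, ← h2]
  exact hL.apply_eq f ψ m

/-- The Lagrangian sees only the value of a connection at m, so a global connection with the
prescribed value suffices and no germ of a connection has to be extended. -/
theorem CoupledLagrangian.IsGaugeInvariant.isInvariant {L : B.CoupledLagrangian k Q}
    (hG : ∀ (p : B.Carrier) (g : G), ∃ f : B.GaugeTransformation, ∃ g' ∈ connectedComponent g,
      f.toDiffeomorph p = B.act p g')
    (hQ : ∀ (p : B.Carrier) (q : Q), ∃ φ : GlobalSection (B.matterProj k Q),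
      ∃ q' ∈ connectedComponent q, φ.toFun (B.proj p) = Assoc.mk p q')
    (hL : L.IsGaugeInvariant) : L.IsInvariant := by
  rintro m a A A' b b' ⟨w, w', ⟨U, hU, hm, γ, σ, hγ, hσ, hγσ, rfl, rfl, rfl⟩, rfl, rfl⟩ hb
  obtain ⟨f, hf⟩ := exists_gaugeTransformation_eventually_eq (Q := Q) hG hU hγ hm
  obtain ⟨V, hV, hmV, γ', φ, hγ', hφ, -, -, rfl, -⟩ := id hb
  obtain ⟨ψ, hψ⟩ := exists_globalSection_eventuallyEq hQ hV hφ hmV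
  obtain ⟨A₀, hA₀⟩ := exists_connection_eq_mk_jet hσ hU hm
  have h1 : ψ.jet m = hφ.jet hV hmV := IsSectionOn.jet_eq_of_eventuallyEq _ _ _ _ _ _ hψ
  have hfψ : ∀ᶠ x in 𝓝 m, B.gaugeActAssoc (γ x) (ψ.toFun x) = (f.mapSection ψ).toFun x := by
    filter_upwards [hf] with x hx
    exact (hx.2 _ (ψ.isSectionOn.proj_eq x (mem_univ x))).symm
  obtain ⟨W, hW, hWo, hmW⟩ := eventually_nhds_iff.1 hfψ
  -- The matter jet b' was formed with γ', whereas f extends the germ of γ. The two have the same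
  -- jet at m, and the action depends on nothing more.
  have h2 : (f.mapSection ψ).jet m = b' := by
    refine jetActs_gaugeActAssoc_unique ?_ hb
    have hs := (f.mapSection ψ).isSectionOn.mono (subset_univ (U ∩ W))
    refine ⟨U ∩ W, hU.inter hWo, ⟨hm, hmW⟩, γ, ψ.toFun, hγ.mono inter_subset_left,
      ψ.isSectionOn.mono (subset_univ _), ⟨hs.contMDiffOn.congr fun x hx => hW x hx.2,
        fun x hx => by rw [hW x hx.2]; exact hs.proj_eq x hx⟩, ?_, ?_, ?_⟩
    · exact IsSectionOn.jet_eq_of_eventuallyEq _ _ _ _ _ _ Filter.EventuallyEq.rfl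
    · exact IsSectionOn.jet_eq_of_eventuallyEq _ _ _ _ _ _ hψ
    · exact IsSectionOn.jet_eq_of_eventuallyEq _ _ _ _ _ _ hfψ
  have h3 : f.connectionMap (A₀.toFun m) = ConnectionAt.mk (hγσ.jet hU hm) := by
    rw [hA₀]
    refine congrArg ConnectionAt.mk ?_
    have hfσ : IsSectionOn B.proj (fun x => f.toContMDiffMap (σ x)) U :=
      ⟨f.toContMDiffMap.contMDiff.comp_contMDiffOn hσ.contMDiffOn,
        fun x hx => (f.proj_map _).trans (hσ.proj_eq x hx)⟩
    refine (hσ.map_jet hU hm f.toContMDiffMap f.proj_map hfσ).trans ?_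
    refine IsSectionOn.jet_eq_of_eventuallyEq _ _ _ _ _ _ ?_
    filter_upwards [hf, hU.mem_nhds hm] with x hx hxU
    exact hx.1 _ (hσ.proj_eq x hxU)
  rw [← h1, ← h2, ← h3, ← hA₀]
  exact hL.apply_eq f A₀ ψ m

end PrincipalBundle
end GaugeTheory

theorem mainTheorem3 {n d k : ℕ} {M G Q : Type*}
    [TopologicalSpace M] [ChartedSpace (GaugeTheory.𝔼 n) M] [IsManifold (𝓡 n) ∞ M]
    [T2Space M] [SigmaCompactSpace M] [GaugeTheory.OrientedAtlas n M]
    [TopologicalSpace G] [ChartedSpace (GaugeTheory.𝔼 d) G] [Group G] [LieGroup (𝓡 d) ∞ G]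
    (B : GaugeTheory.PrincipalBundle n d G M)
    [TopologicalSpace Q] [ChartedSpace (GaugeTheory.𝔼 k) Q] [IsManifold (𝓡 k) ∞ Q]
    [MulAction G Q] [ContMDiffSMul (𝓡 d) (𝓡 k) ∞ G Q]
    (hG : ∀ (p : B.Carrier) (g : G), ∃ f : B.GaugeTransformation, ∃ g' ∈ connectedComponent g,
      f.toDiffeomorph p = B.act p g')
    (hQ : ∀ (p : B.Carrier) (q : Q), ∃ φ : GaugeTheory.GlobalSection (B.matterProj k Q),
      ∃ q' ∈ connectedComponent q,
        φ.toFun (B.proj p) = GaugeTheory.PrincipalBundle.Assoc.mk p q') :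
    (∀ L : B.MatterLagrangian k Q, L.IsGaugeInvariant ↔ L.IsInvariant) ∧
      (∀ L : B.CoupledLagrangian k Q, L.IsGaugeInvariant ↔ L.IsInvariant) :=
  ⟨fun _ => ⟨fun h => h.isInvariant hG hQ, fun h => h.isGaugeInvariant⟩,
    fun _ => ⟨fun h => h.isInvariant hG hQ, fun h => h.isGaugeInvariant⟩⟩
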